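/- Let $k\ge 3$ and consider the cycle query $$C_k = S_1(x_1,x_2),\,S_2(x_2,x_3),\,\dots,\,S_k(x_k,x_1),$$ on instances in which all relations $S_j\subseteq [n]\times[n]$ have the same number $m$ of tuples, that is, the same size $M=2m\log_2 n$ in bits; the answer on an instance $I$ is the set $C_k(I)$ of all $t\in[n]^k$ with $(t_j,t_{(j \bmod k)+1})\in S_j$ for all $j$. Model (Massively Parallel Computation, MPC). There are $p\ge 1$ servers with unlimited local computing power and a shared uniformly random element of a finite set (for hash functions). The input is partitioned among the servers, each storing at most $\lceil km/p\rceil$ of the $km$ tuples; the partition is otherwise arbitrary. Every server knows the sizes $p,n,m$ and the heavy-hitter statistics: for each relation and each of its two attributes, the values that occur in at least $m/p$ tuples at that attribute, with their frequencies. In each round every server sends a bit string to every server, depending only on what it knows: its part of the input, the random element, the statistics, and the messages it received in earlier rounds. The load is the maximum number of bits received by any server in any round. The algorithm computes the query if the union of the servers' final outputs is $C_k(I)$. Then $C_k$ can be computed by an MPC algorithm in at most $\lceil k/2\rceil$ rounds with load $\tilde O(M/p^{2/k})$, for every input with $m\ge p$: there are, for each fixed $k$, a family of randomized MPC algorithms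 (one for each $p,n,m$), each using at most $\lceil k/2\rceil$ rounds, and an exponent $b$, such that for every $a\in\mathbb N$ there is a constant $C>0$ (depending only on $k$ and $a$) such that for all $p\ge1$, all $n$, all $m\ge p$, every instance with $|S_1|=\dots=|S_k|=m$ and every such partition of it, the algorithm always outputs exactly $C_k(I)$, and with probability at least $1-p^{-a}$ its load is at most $$C\,(1+\log p)^b\cdot \frac{M}{p^{2/k}} .$$ -/

import Mathlib

/-- A full conjunctive query without self-joins, with variables `x_0, …, x_{k-1}` and atoms
`S_0, …, S_{ℓ-1}`; position `i` of atom `S_j` carries the variable `x_{var j i}`. -/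
structure ConjQuery (k ℓ : ℕ) where
  /-- the arity of each atom -/
  arity : Fin ℓ → ℕ
  /-- the variable at each position of each atom -/
  var : (j : Fin ℓ) → Fin (arity j) → Fin k
  /-- every variable occurs in the body -/
  full : ∀ x : Fin k, ∃ j i, var j i = x

namespace ConjQuery

variable {k ℓ : ℕ}

/-- A database instance over the domain `Fin n`: a finite relation (a set of tuples) for each
atom of the query. -/
abbrev Instance (q : ConjQuery k ℓ) (n : ℕ) : Type :=
  (j : Fin ℓ) → Finset (Fin (q.arity j) → Fin n)

/-- The answer `q(I)`: all assignments of the variables that satisfy every atom. -/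
def answer (q : ConjQuery k ℓ) {n : ℕ} (I : q.Instance n) : Finset (Fin k → Fin n) :=
  Finset.univ.filter fun t => ∀ j, (fun i => t (q.var j i)) ∈ I j

/-- The frequency (degree) of the value `v` at position `i` of the relation `S_j`. -/
def freq (q : ConjQuery k ℓ) {n : ℕ} (I : q.Instance n) (j : Fin ℓ) (i : Fin (q.arity j))
    (v : Fin n) : ℕ :=
  ((I j).filter fun t => t i = v).card

/-- The type of the data statistics on the frequencies of single values. -/
abbrev Stats (q : ConjQuery k ℓ) (n : ℕ) : Type :=
  (j : Fin ℓ) → Fin (q.arity j) → Fin n → ℕ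

/-- The heavy-hitter statistics of an instance, for `p` servers: for every position of every
relation `S_j`, the values of frequency at least `|S_j| / p` together with their frequencies.
Values that are not heavy hitters are reported as `0`. -/
def heavyHitters (q : ConjQuery k ℓ) {n : ℕ} (p : ℕ) (I : q.Instance n) : q.Stats n :=
  fun j i v => if (I j).card ≤ p * q.freq I j i v then q.freq I j i v else 0

/-- `F` is a uniform partition of the input `I` among `p` servers: every tuple of every relation
is stored at exactly one server, and no server stores more than `⌈N / p⌉` of the `N` input
tuples. -/
structure IsUniformPartition (q : ConjQuery k ℓ) {n p : ℕ} (I : q.Instance n)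
    (F : Fin p → q.Instance n) : Prop where
  cover : ∀ j t, t ∈ I j ↔ ∃ s, t ∈ F s j
  disjoint : ∀ j s s', s ≠ s' → Disjoint (F s j) (F s' j)
  balanced : ∀ s, ∑ j, (F s j).card ≤ ⌈((∑ j, (I j).card : ℕ) : ℝ) / (p : ℝ)⌉₊

end ConjQuery

/-- The cycle query `C_k = S_0(x_0, x_1), S_1(x_1, x_2), …, S_{k-1}(x_{k-1}, x_0)`. -/
def cycleQuery (k : ℕ) : ConjQuery k k where
  arity _ := 2
  var j := ![j, ⟨(j.val + 1) % k, Nat.mod_lt _ j.pos⟩]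
  full x := ⟨x, 0, rfl⟩

/-- What a server has received so far: for each completed round, in chronological order, the
message (a bit string) received from each of the `p` servers in that round. -/
abbrev MPCHistory (p : ℕ) : Type := List (Fin p → List Bool)

/-- A randomized algorithm in the Massively Parallel Computation model with `p` servers, for the
query `q` over the domain `Fin n`. The servers share random bits (such as the choice of the hash
functions), modelled by a uniformly distributed element of a finite set `Rand`, and know the data
statistics. In each round every server sends a bit string to every server. What a server sends
and outputs is an arbitrary function of what it knows: the shared random element, the statistics,
its own identity, its part of the input, and the messages that it received in earlier rounds. -/
structure MPCAlgorithm {k ℓ : ℕ} (q : ConjQuery k ℓ) (p n : ℕ) where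
  /-- the values of the shared random element -/
  Rand : Type
  [fintypeRand : Fintype Rand]
  [nonemptyRand : Nonempty Rand]
  /-- the number of rounds -/
  rounds : ℕ
  /-- `send ω σ s D h s'` is the message that server `s` sends to server `s'` in the round that
  follows the history `h` of received messages, on input part `D` and statistics `σ` -/
  send : Rand → q.Stats n → Fin p → q.Instance n → MPCHistory p → Fin p → List Bool
  /-- the output of a server after the last round -/
  output : Rand → q.Stats n → Fin p → q.Instance n → MPCHistory p → Finset (Fin k → Fin n)

namespace MPCAlgorithm

attribute [instance] MPCAlgorithm.fintypeRand MPCAlgorithm.nonemptyRand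

variable {k ℓ : ℕ} {q : ConjQuery k ℓ} {p n : ℕ}

/-- The messages received by each server during the first `r` rounds. -/
def history (A : MPCAlgorithm q p n) (ω : A.Rand) (σ : q.Stats n) (F : Fin p → q.Instance n) :
    ℕ → Fin p → MPCHistory p
  | 0, _ => []
  | r + 1, s => A.history ω σ F r s ++ [fun s' => A.send ω σ s' (F s') (A.history ω σ F r s') s]

/-- The number of bits received by server `s` in round `r` (rounds are numbered from `0`). -/
def received (A : MPCAlgorithm q p n) (ω : A.Rand) (σ : q.Stats n) (F : Fin p → q.Instance n)
    (r : ℕ) (s : Fin p) : ℕ :=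
  ∑ s', (A.send ω σ s' (F s') (A.history ω σ F r s') s).length

/-- The maximum load: the maximum number of bits received by any server during any round. -/
def maxLoad (A : MPCAlgorithm q p n) (ω : A.Rand) (σ : q.Stats n) (F : Fin p → q.Instance n) : ℕ :=
  (Finset.range A.rounds).sup fun r => Finset.univ.sup fun s => A.received ω σ F r s

/-- The union of the outputs of the `p` servers at the end of the execution. -/
def result (A : MPCAlgorithm q p n) (ω : A.Rand) (σ : q.Stats n) (F : Fin p → q.Instance n) :
    Finset (Fin k → Fin n) :=
  Finset.univ.biUnion fun s => A.output ω σ s (F s) (A.history ω σ F A.rounds s)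

open Classical in
/-- The probability of an event over the uniform choice of the shared random element. -/
noncomputable def prob (A : MPCAlgorithm q p n) (E : A.Rand → Prop) : ℝ :=
  ((Finset.univ.filter E).card : ℝ) / (Fintype.card A.Rand : ℝ)

end MPCAlgorithm

/-! Since `2 ≤ ⌈k/2⌉` for `k ≥ 3`, it is enough to find a two-round algorithm with load about `L = m
/ r ^ 2` tuples, where `r = gridSide k p` is the integer part of the `k`-th root of `p`. Then `r ^ k
≤ p ≤ (2 * r) ^ k`, so `L` is of order `m / p ^ (2/k)`, and `r ^ 3 ≤ p ≤ m`.

The algorithm is a hypercube join refined by heavy values. A value of a variable is heavy if its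
degree in one of the two adjacent relations is at least `m / r`; each variable has at most `2 * r`
of them. A cell fixes for every variable either a heavy value or a hash coordinate. The coordinate
ranges over `r` parts, or, when the preceding variable has the heavy value `h` of degree `d`, over
`r + d * r ^ 2 / m` parts. Summing the numbers of parts over all patterns of heavy values factorizes
over the variables and gives at most `(4 * r) ^ k` cells (`card_cells_le`), hence at most `4 ^ k`
cells per server.

Consider the tuples of `S_j` that reach a given cell (`unifProb_cellLoad_le`). If both values are
light, two-dimensional hashing leaves about `L` tuples. If both are heavy, one tuple is left. If
only the first is heavy, the enlarged share of the second variable reduces its `d` tuples to about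
`L`. The remaining case, light first value and heavy second value, could leave about `m / r` tuples.
There, first values of degree more than `L` in `S_{j-1}` are at most `r ^ 2` in number, and hashing
them into `r` parts leaves about `r ≤ L`. Tuples with the other (low) first values are deferred: the
first round brings them to buckets indexed by the heavy value and the hash of the light one,
together with the tuples of `S_{j-1}` that end in low values. In the second round a deferred tuple
goes only to those cells that also fit a matching tuple of `S_{j-1}`. A cell thus gets no more
deferred tuples than it received from `S_{j-1}` directly (`card_deferred_fits_le`). There are at
most `6 * k * r ^ 3 ≤ 6 * k * p` buckets.

Every answer meets in the cell determined by its own values, whatever the hash functions are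
(`route_complete`), so the output is always correct and only the load is random. The loads are
controlled by an exponential moment bound (`unifProb_sum_gt_le`, `unifProb_hash_load_pair`) and a
union bound over `O(p ^ 2)` events (`unifProb_not_loadsLE_le`). -/

/-- The probability of an event under the uniform distribution on a finite type. -/
noncomputable def unifProb {Ω : Type*} [Fintype Ω] (E : Ω → Prop) : ℝ :=
  open Classical in ((Finset.univ.filter E).card : ℝ) / (Fintype.card Ω : ℝ)

/-! ### Uniform probabilities: union bounds and resampling of one coordinate. -/

section UnifProb

variable {Ω : Type*} [Fintype Ω]

lemma unifProb_eq (E : Ω → Prop) [DecidablePred E] :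
    unifProb E = ((Finset.univ.filter E).card : ℝ) / (Fintype.card Ω : ℝ) := by
  unfold unifProb
  congr!

lemma unifProb_nonneg (E : Ω → Prop) : 0 ≤ unifProb E := by
  unfold unifProb; positivity

lemma unifProb_mono {E E' : Ω → Prop} (h : ∀ ω, E ω → E' ω) : unifProb E ≤ unifProb E' := by
  classical
  unfold unifProb
  gcongr with ω
  exact h ω

lemma unifProb_false : unifProb (fun _ : Ω => False) = 0 := by
  simp [unifProb]

lemma unifProb_or_le (E E' : Ω → Prop) :
    unifProb (fun ω => E ω ∨ E' ω) ≤ unifProb E + unifProb E' := by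
  classical
  rw [unifProb_eq, unifProb_eq, unifProb_eq, ← add_div]
  gcongr
  rw [Finset.filter_or]
  exact_mod_cast Finset.card_union_le _ _

lemma unifProb_exists_le {ι : Type*} (s : Finset ι) (E : ι → Ω → Prop) :
    unifProb (fun ω => ∃ i ∈ s, E i ω) ≤ ∑ i ∈ s, unifProb (E i) := by
  classical
  induction s using Finset.induction_on with
  | empty => simp [unifProb]
  | insert i s hi ih =>
    rw [Finset.sum_insert hi]
    refine (unifProb_mono (E' := fun ω => E i ω ∨ ∃ i ∈ s, E i ω) ?_).trans
      ((unifProb_or_le _ _).trans (by gcongr))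
    intro ω h
    simpa using h

lemma one_sub_unifProb_le [Nonempty Ω] {E E' : Ω → Prop} (h : ∀ ω, ¬ E' ω → E ω) :
    1 - unifProb E' ≤ unifProb E := by
  have h1 : unifProb (fun ω => E' ω ∨ E ω) = 1 := by
    classical
    rw [unifProb_eq, Finset.filter_true_of_mem (fun ω _ => by by_cases h' : E' ω <;> simp [h', h ω]),
      Finset.card_univ, div_self]
    exact_mod_cast Fintype.card_ne_zero
  linarith [unifProb_or_le E' E]

/-- An event on a finite product has probability at most `δ` as soon as resampling one coordinate
gives probability at most `δ`, whatever the other coordinates are. -/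
lemma unifProb_le_of_update {ι β : Type*} [Fintype ι] [DecidableEq ι] [Fintype β] [Nonempty β]
    (j : ι) {E : (ι → β) → Prop} {δ : ℝ}
    (h : ∀ ω, unifProb (fun x => E (Function.update ω j x)) ≤ δ) : unifProb E ≤ δ := by
  classical
  have hc : (0 : ℝ) < Fintype.card β := by exact_mod_cast Fintype.card_pos
  have hC : (0 : ℝ) < Fintype.card (ι → β) := by exact_mod_cast Fintype.card_pos
  have key : ∑ ω : ι → β, ∑ x : β, (if E (Function.update ω j x) then (1 : ℝ) else 0)
      = Fintype.card β * ∑ ω : ι → β, (if E ω then (1 : ℝ) else 0) := by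
    -- Exchanging the fresh value with the old coordinate is an involution that preserves the
    -- uniform measure.
    let e : (ι → β) × β ≃ (ι → β) × β :=
      { toFun := fun a => (Function.update a.1 j a.2, a.1 j)
        invFun := fun a => (Function.update a.1 j a.2, a.1 j)
        left_inv := fun a => by simp
        right_inv := fun a => by simp }
    rw [← Fintype.sum_prod_type']
    refine (e.sum_comp (fun a : (ι → β) × β => if E a.1 then (1 : ℝ) else 0)).trans ?_
    rw [Fintype.sum_prod_type, Finset.mul_sum]
    refine Finset.sum_congr rfl fun ω _ => ?_
    change ∑ _x : β, (if E ω then (1 : ℝ) else 0) = _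
    rw [Finset.sum_const, Finset.card_univ, nsmul_eq_mul]
  unfold unifProb at h ⊢
  rw [div_le_iff₀ hC]
  have h2 : ∑ ω : ι → β, ∑ x : β, (if E (Function.update ω j x) then (1 : ℝ) else 0)
      ≤ ∑ _ω : ι → β, δ * Fintype.card β := by
    refine Finset.sum_le_sum fun ω _ => ?_
    have := h ω
    rw [div_le_iff₀ hc] at this
    simpa [Finset.sum_boole] using this
  rw [key, Finset.sum_const, Finset.sum_boole, Finset.card_univ, nsmul_eq_mul] at h2
  have h3 : (Fintype.card β : ℝ) * ((Finset.univ.filter E).card : ℝ)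
      ≤ Fintype.card β * (δ * Fintype.card (ι → β)) := by linarith
  exact le_of_mul_le_mul_left h3 hc

end UnifProb

/-! ### Concentration of hash loads. -/

section Hashing

/-- A Chernoff bound for independent variables with values in `[0, W]` and total mean at
most `W`. -/
lemma unifProb_sum_gt_le {α β : Type*} [Fintype α] [DecidableEq α] [Fintype β] [Nonempty β]
    (X : α → β → ℝ) {W : ℝ} (t : ℝ) (hW : 0 < W) (h0 : ∀ a b, 0 ≤ X a b) (h1 : ∀ a b, X a b ≤ W)
    (hsum : ∑ a, ∑ b, X a b ≤ W * Fintype.card β) :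
    unifProb (fun f : α → β => (2 + t) * W < ∑ a, X a (f a)) ≤ Real.exp (-t) := by
  classical
  have hc : (0 : ℝ) < Fintype.card β := by exact_mod_cast Fintype.card_pos
  have hC : (0 : ℝ) < Fintype.card (α → β) := by exact_mod_cast Fintype.card_pos
  have hexp : ∀ x : ℝ, 0 ≤ x → x ≤ 1 → Real.exp x ≤ 1 + 2 * x := by
    intro x hx0 hx1
    have := Real.abs_exp_sub_one_le (x := x) (by rwa [abs_of_nonneg hx0])
    rw [abs_of_nonneg hx0] at this
    linarith [le_abs_self (Real.exp x - 1)]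
  -- The moment generating function at `1 / W` factorizes by independence; `exp x ≤ 1 + 2 * x` on
  -- `[0, 1]` and total mean at most `W` bound it by `exp 2`, the source of the `2` in `2 + t`.
  have hM : ∑ f : α → β, Real.exp ((∑ a, X a (f a)) / W)
      ≤ Fintype.card (α → β) * Real.exp 2 := by
    calc ∑ f : α → β, Real.exp ((∑ a, X a (f a)) / W)
        = ∑ f : α → β, ∏ a, Real.exp (X a (f a) / W) := by
          simp_rw [Finset.sum_div, Real.exp_sum]
      _ = ∏ a, ∑ b, Real.exp (X a b / W) := by
          rw [Finset.prod_univ_sum]; simp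
      _ ≤ ∏ a, (Fintype.card β * Real.exp (2 * (∑ b, X a b) / (W * Fintype.card β))) := by
          refine Finset.prod_le_prod (fun a _ => by positivity) fun a _ => ?_
          calc ∑ b, Real.exp (X a b / W) ≤ ∑ b, (1 + 2 * (X a b / W)) :=
                Finset.sum_le_sum fun b _ => hexp _ (div_nonneg (h0 a b) hW.le)
                  ((div_le_one hW).2 (h1 a b))
            _ = Fintype.card β * (2 * (∑ b, X a b) / (W * Fintype.card β) + 1) := by
                rw [Finset.sum_add_distrib, ← Finset.mul_sum, ← Finset.sum_div]
                simp only [Finset.sum_const, Finset.card_univ, nsmul_eq_mul, mul_one]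
                field_simp
                ring
            _ ≤ _ := by
                gcongr
                exact Real.add_one_le_exp _
      _ = Fintype.card (α → β) * Real.exp (∑ a, 2 * (∑ b, X a b) / (W * Fintype.card β)) := by
          rw [Finset.prod_mul_distrib, Real.exp_sum]
          simp
      _ ≤ _ := by
          gcongr
          rw [← Finset.sum_div, ← Finset.mul_sum, div_le_iff₀ (by positivity)]
          linarith
  unfold unifProb
  rw [div_le_iff₀ hC]
  have hmk : ((Finset.univ.filter fun f : α → β => (2 + t) * W < ∑ a, X a (f a)).card : ℝ)
      * Real.exp (2 + t) ≤ ∑ f : α → β, Real.exp ((∑ a, X a (f a)) / W) := by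
    rw [← nsmul_eq_mul, ← Finset.sum_const]
    refine (Finset.sum_le_sum (g := fun f => Real.exp ((∑ a, X a (f a)) / W)) ?_).trans
      (Finset.sum_le_sum_of_subset_of_nonneg (Finset.filter_subset _ _)
        fun _ _ _ => (Real.exp_pos _).le)
    intro f hf
    rw [Finset.mem_filter] at hf
    exact Real.exp_le_exp.2 ((le_div_iff₀ hW).2 hf.2.le)
  have h3 := hmk.trans hM
  have h4 : Real.exp (2 + t) * Real.exp (-t) = Real.exp 2 := by
    rw [← Real.exp_add]; congr 1; ring
  rw [← h4] at h3
  have h5 : (0 : ℝ) < Real.exp (2 + t) := Real.exp_pos _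
  nlinarith

variable {τ ν β : Type*} [Fintype ν] [DecidableEq ν] [Fintype β] [Nonempty β] [DecidableEq β]

/-- Items hashed by a key: the number of items whose hash value lies in `A`. -/
lemma unifProb_hash_load (R : Finset τ) (κ : τ → ν) (A : Finset β) {W : ℝ} (t : ℝ) (hW : 0 < W)
    (hfib : ∀ v, ((R.filter fun x => κ x = v).card : ℝ) ≤ W)
    (hsum : (R.card : ℝ) * A.card ≤ W * Fintype.card β) :
    unifProb (fun f : ν → β => (2 + t) * W < ((R.filter fun x => f (κ x) ∈ A).card : ℝ))
      ≤ Real.exp (-t) := by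
  have hR : ∀ S : Finset τ, ∑ v, ((S.filter fun x => κ x = v).card : ℝ) = S.card := by
    intro S
    exact_mod_cast (Finset.card_eq_sum_card_fiberwise (f := κ) (t := Finset.univ)
      (fun _ _ => Finset.mem_coe.2 (Finset.mem_univ _))).symm
  refine (unifProb_mono ?_).trans (unifProb_sum_gt_le
    (fun v b => if b ∈ A then ((R.filter fun x => κ x = v).card : ℝ) else 0) t hW ?_ ?_ ?_)
  · intro f hf
    refine hf.trans_eq ?_
    rw [← hR]
    refine Finset.sum_congr rfl fun v _ => ?_
    split_ifs with h
    · congr 2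
      ext x
      simp only [Finset.mem_filter]
      constructor
      · rintro ⟨⟨a, _⟩, c⟩; exact ⟨a, c⟩
      · rintro ⟨a, rfl⟩; exact ⟨⟨a, h⟩, rfl⟩
    · rw [Nat.cast_eq_zero, Finset.card_eq_zero, Finset.filter_eq_empty_iff]
      intro x hx hxv
      rw [Finset.mem_filter, hxv] at hx
      exact h hx.2
  · intro v b
    split_ifs <;> positivity
  · intro v b
    split_ifs
    · exact hfib v
    · exact hW.le
  · refine le_trans (le_of_eq ?_) hsum
    simp_rw [← Finset.sum_filter]
    simp only [Finset.filter_mem_eq_inter, Finset.univ_inter, Finset.sum_const, nsmul_eq_mul]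
    rw [← Finset.mul_sum, hR, mul_comm]

variable {ι : Type*} [Fintype ι] [DecidableEq ι]

lemma unifProb_hash_load_coord (i : ι) (R : Finset τ) (κ : τ → ν) (A : Finset β) {W : ℝ} (t : ℝ)
    (hW : 0 < W) (hfib : ∀ v, ((R.filter fun x => κ x = v).card : ℝ) ≤ W)
    (hsum : (R.card : ℝ) * A.card ≤ W * Fintype.card β) :
    unifProb (fun ω : ι → ν → β =>
      (2 + t) * W < ((R.filter fun x => ω i (κ x) ∈ A).card : ℝ)) ≤ Real.exp (-t) := by
  refine unifProb_le_of_update i fun ω => ?_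
  simpa using unifProb_hash_load R κ A t hW hfib hsum

lemma unifProb_load_le_of_coord {S : (ι → ν → β) → Finset τ} (i : ι) (R : Finset τ) (κ : τ → ν)
    (A : Finset β) {W T t : ℝ} (hT : (2 + t) * W ≤ T)
    (hS : ∀ ω, ∀ x ∈ S ω, x ∈ R ∧ ω i (κ x) ∈ A) (hW : 0 < W)
    (hfib : ∀ v, ((R.filter fun x => κ x = v).card : ℝ) ≤ W)
    (hsum : (R.card : ℝ) * A.card ≤ W * Fintype.card β) :
    unifProb (fun ω => T < ((S ω).card : ℝ)) ≤ Real.exp (-t) := by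
  refine (unifProb_mono fun ω hω => ?_).trans (unifProb_hash_load_coord i R κ A t hW hfib hsum)
  have : ((S ω).card : ℝ) ≤ ((R.filter fun x => ω i (κ x) ∈ A).card : ℝ) := by
    exact_mod_cast Finset.card_le_card fun x hx => Finset.mem_filter.2 (hS ω x hx)
  linarith

/-- Markov's inequality for degrees. It bounds the number of events in the union bound of
`unifProb_hash_load_pair` and the number of values that are not low. -/
lemma card_large_fibers_le (R : Finset τ) (κ : τ → ν) {d c : ℝ} (hd : 0 < d)
    (hR : (R.card : ℝ) ≤ c * d) :
    ((Finset.univ.filter fun v => d < ((R.filter fun x => κ x = v).card : ℝ)).card : ℝ) ≤ c := by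
  have h1 : ((Finset.univ.filter fun v => d < ((R.filter fun x => κ x = v).card : ℝ)).card : ℝ) * d
      ≤ R.card := by
    have h2 : (R.card : ℝ) = ∑ v, ((R.filter fun x => κ x = v).card : ℝ) := by
      exact_mod_cast Finset.card_eq_sum_card_fiberwise (f := κ) (t := Finset.univ)
        (fun _ _ => Finset.mem_coe.2 (Finset.mem_univ _))
    rw [h2, ← nsmul_eq_mul, ← Finset.sum_const]
    refine (Finset.sum_le_sum fun v hv => (Finset.mem_filter.1 hv).2.le).trans
      (Finset.sum_le_sum_of_subset_of_nonneg (Finset.filter_subset _ _) fun _ _ _ => by positivity)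
  exact le_of_mul_le_mul_right (h1.trans hR) hd

/-- Pairs hashed by two independent hash functions: the load of a cell of the grid, when no key
occurs in more than `s * L` of the `s ^ 2 * L` pairs. -/
lemma unifProb_hash_load_pair {i j : ι} (hij : i ≠ j) (R : Finset τ) (κ κ' : τ → ν)
    (hinj : ∀ x ∈ R, ∀ y ∈ R, κ x = κ y → κ' x = κ' y → x = y)
    (A B : Finset β) {L s t : ℝ} (hL : 1 ≤ L) (hs : 1 ≤ s) (ht : 0 ≤ t)
    (hR : (R.card : ℝ) ≤ s ^ 2 * L)
    (hfib : ∀ v, ((R.filter fun x => κ x = v).card : ℝ) ≤ s * L)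
    (hfib' : ∀ v, ((R.filter fun x => κ' x = v).card : ℝ) ≤ s * L)
    (hA : s * A.card ≤ 2 * Fintype.card β) (hB : s * B.card ≤ 2 * Fintype.card β) :
    unifProb (fun ω : ι → ν → β => (2 + t) ^ 2 * (4 * L) <
      ((R.filter fun x => ω i (κ x) ∈ A ∧ ω j (κ' x) ∈ B).card : ℝ))
      ≤ (s ^ 2 + 2) * Real.exp (-t) := by
  -- The second hash function must thin out the whole set (`G1`) and every fiber of size more than
  -- `L` (`G2`); smaller fibers need no thinning, so at most `s ^ 2` fibers enter the union bound.
  set V := Finset.univ.filter fun v => L < ((R.filter fun x => κ x = v).card : ℝ) with hV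
  have hVc : (V.card : ℝ) ≤ s ^ 2 := card_large_fibers_le R κ (by linarith) hR
  have hβ : (0 : ℝ) < Fintype.card β := by exact_mod_cast Fintype.card_pos
  set G1 : (ι → ν → β) → Prop := fun ω =>
    (2 + t) * (2 * s * L) < ((R.filter fun x => ω j (κ' x) ∈ B).card : ℝ) with hG1
  set G2 : ν → (ι → ν → β) → Prop := fun v ω => (2 + t) * (2 * L) <
    (((R.filter fun x => κ x = v).filter fun x => ω j (κ' x) ∈ B).card : ℝ) with hG2
  set G3 : (ι → ν → β) → Prop := fun ω => ¬ G1 ω ∧ (∀ v ∈ V, ¬ G2 v ω) ∧ (2 + t) ^ 2 * (4 * L) <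
      ((R.filter fun x => ω i (κ x) ∈ A ∧ ω j (κ' x) ∈ B).card : ℝ) with hG3
  have b1 : unifProb G1 ≤ Real.exp (-t) := by
    refine unifProb_hash_load_coord j R κ' B t (by positivity) (fun v => ?_) ?_
    · nlinarith [hfib' v]
    · calc (R.card : ℝ) * B.card ≤ (s ^ 2 * L) * B.card := by gcongr
        _ = s * L * (s * B.card) := by ring
        _ ≤ s * L * (2 * Fintype.card β) := by gcongr
        _ = _ := by ring
  have b2 : ∀ v, unifProb (G2 v) ≤ Real.exp (-t) := by
    intro v
    refine unifProb_hash_load_coord j _ κ' B t (by positivity) (fun v' => ?_) ?_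
    · have : (((R.filter fun x => κ x = v).filter fun x => κ' x = v').card) ≤ 1 := by
        rw [Finset.card_le_one]
        intro x hx y hy
        simp only [Finset.mem_filter] at hx hy
        exact hinj x hx.1.1 y hy.1.1 (hx.1.2.trans hy.1.2.symm) (hx.2.trans hy.2.symm)
      have : (((R.filter fun x => κ x = v).filter fun x => κ' x = v').card : ℝ) ≤ 1 := by
        exact_mod_cast this
      linarith
    · calc ((R.filter fun x => κ x = v).card : ℝ) * B.card ≤ (s * L) * B.card := by
            gcongr; exact hfib v
        _ = L * (s * B.card) := by ring
        _ ≤ L * (2 * Fintype.card β) := by gcongr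
        _ = _ := by ring
  have b3 : unifProb G3 ≤ Real.exp (-t) := by
    -- The events `G1` and `G2` depend on `ω j` only, so `ω i` is still free once they are excluded;
    -- the surviving pairs satisfy the one-hash bound with `W = (2 + t) * (4 * L)`.
    refine unifProb_le_of_update i fun ω => ?_
    have hj : ∀ x : ν → β, Function.update ω i x j = ω j := fun x =>
      Function.update_of_ne hij.symm _ _
    by_cases hg : ¬ G1 ω ∧ ∀ v ∈ V, ¬ G2 v ω
    · have hW : 0 < (2 + t) * (4 * L) := by positivity
      refine (unifProb_mono ?_).trans
        (unifProb_hash_load (R.filter fun x => ω j (κ' x) ∈ B) κ A t hW ?_ ?_)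
      · rintro f ⟨-, -, h⟩
        simp only [hj, Function.update_self] at h
        rw [Finset.filter_filter]
        simp only [and_comm] at h ⊢
        linarith
      · intro v
        by_cases hv : v ∈ V
        · have := hg.2 v hv
          simp only [hG2, not_lt] at this
          rw [Finset.filter_comm]
          nlinarith
        · have h1 : ((R.filter fun x => κ x = v).card : ℝ) ≤ L := by
            simpa [hV] using hv
          have h2 : (((R.filter fun x => ω j (κ' x) ∈ B).filter fun x => κ x = v).card : ℝ)
              ≤ ((R.filter fun x => κ x = v).card : ℝ) := by
            exact_mod_cast Finset.card_le_card
              (Finset.filter_subset_filter _ (Finset.filter_subset _ _))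
          nlinarith
      · have h1 := hg.1
        simp only [hG1, not_lt] at h1
        calc ((R.filter fun x => ω j (κ' x) ∈ B).card : ℝ) * A.card
            ≤ ((2 + t) * (2 * s * L)) * A.card := by gcongr
          _ = (2 + t) * (2 * L) * (s * A.card) := by ring
          _ ≤ (2 + t) * (2 * L) * (2 * Fintype.card β) := by gcongr
          _ = _ := by ring
    · have : (fun x => G3 (Function.update ω i x)) = fun _ => False := by
        funext x
        simp only [hG3, hG1, hG2, hj, eq_iff_iff, iff_false]
        rintro ⟨h1, h2, -⟩
        exact hg ⟨h1, h2⟩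
      rw [this, unifProb_false]
      positivity
  calc _ ≤ unifProb (fun ω => G1 ω ∨ (∃ v ∈ V, G2 v ω) ∨ G3 ω) := by
        refine unifProb_mono fun ω h => ?_
        by_cases h1 : G1 ω
        · exact Or.inl h1
        · by_cases h2 : ∃ v ∈ V, G2 v ω
          · exact Or.inr (Or.inl h2)
          · push Not at h2
            exact Or.inr (Or.inr ⟨h1, h2, h⟩)
    _ ≤ unifProb G1 + (∑ v ∈ V, unifProb (G2 v) + unifProb G3) := by
        refine (unifProb_or_le _ _).trans ?_
        gcongr
        refine (unifProb_or_le _ _).trans ?_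
        gcongr
        exact unifProb_exists_le _ _
    _ ≤ Real.exp (-t) + (V.card * Real.exp (-t) + Real.exp (-t)) := by
        gcongr
        rw [← nsmul_eq_mul, ← Finset.sum_const]
        exact Finset.sum_le_sum fun v _ => b2 v
    _ ≤ _ := by
        have := Real.exp_pos (-t)
        nlinarith

lemma unifProb_load_le_of_pair {S : (ι → ν → β) → Finset τ} {i j : ι} (hij : i ≠ j)
    (R : Finset τ) (κ κ' : τ → ν)
    (hinj : ∀ x ∈ R, ∀ y ∈ R, κ x = κ y → κ' x = κ' y → x = y)
    (A B : Finset β) {L s t : ℝ}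
    (hS : ∀ ω, ∀ x ∈ S ω, x ∈ R ∧ ω i (κ x) ∈ A ∧ ω j (κ' x) ∈ B)
    (hL : 1 ≤ L) (hs : 1 ≤ s) (ht : 0 ≤ t) (hR : (R.card : ℝ) ≤ s ^ 2 * L)
    (hfib : ∀ v, ((R.filter fun x => κ x = v).card : ℝ) ≤ s * L)
    (hfib' : ∀ v, ((R.filter fun x => κ' x = v).card : ℝ) ≤ s * L)
    (hA : s * A.card ≤ 2 * Fintype.card β) (hB : s * B.card ≤ 2 * Fintype.card β) :
    unifProb (fun ω => (2 + t) ^ 2 * (4 * L) < ((S ω).card : ℝ))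
      ≤ (s ^ 2 + 2) * Real.exp (-t) := by
  refine (unifProb_mono fun ω hω => ?_).trans
    (unifProb_hash_load_pair hij R κ κ' hinj A B hL hs ht hR hfib hfib' hA hB)
  have : ((S ω).card : ℝ) ≤
      ((R.filter fun x => ω i (κ x) ∈ A ∧ ω j (κ' x) ∈ B).card : ℝ) := by
    exact_mod_cast Finset.card_le_card fun x hx => Finset.mem_filter.2 (hS ω x hx)
  linarith

/-- A residue class has at most `Q / s + 1` members. Hence one hash function, reduced modulo the
share, serves all shares up to `Q` at the cost of a factor `2`. -/
lemma mul_card_filter_mod_eq_le {Q s : ℕ} (hs : s ≤ Q) (a : ℕ) :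
    s * (Finset.univ.filter fun c : Fin Q => c.val % s = a).card ≤ 2 * Q := by
  rcases Nat.eq_zero_or_pos s with rfl | hs0
  · simp
  have h : (Finset.univ.filter fun c : Fin Q => c.val % s = a).card
      ≤ (Finset.range (Q / s + 1)).card := by
    refine Finset.card_le_card_of_injOn (fun c => c.val / s) ?_ ?_
    · intro c _
      simp only [Finset.coe_range, Set.mem_Iio]
      exact Nat.lt_succ_of_le (Nat.div_le_div_right c.2.le)
    · intro c hc c' hc' h
      simp only [Finset.coe_filter, Finset.mem_univ, true_and, Set.mem_ofPred_eq] at hc hc' h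
      ext
      rw [← Nat.div_add_mod c.val s, ← Nat.div_add_mod c'.val s, hc, hc', h]
  rw [Finset.card_range] at h
  calc _ ≤ s * (Q / s + 1) := Nat.mul_le_mul_left _ h
    _ = s * (Q / s) + s := by ring
    _ ≤ Q + Q := add_le_add (Nat.mul_div_le Q s) hs
    _ = 2 * Q := by ring

end Hashing

/-! ### Fixed-width encoding of sets of tuples and balanced simulation of virtual servers. -/

section Encoding

/-- Finite sets over an alphabet of at most `2 ^ w` symbols are encoded by `w` bits per element. -/
lemma exists_finset_encoding (τ : Type*) [Fintype τ] [DecidableEq τ] {w : ℕ} (hw : 0 < w)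
    (h : Fintype.card τ ≤ 2 ^ w) :
    ∃ (enc : Finset τ → List Bool) (dec : List Bool → Finset τ),
      (∀ S, dec (enc S) = S) ∧ ∀ S, (enc S).length = w * S.card := by
  obtain ⟨code⟩ : Nonempty (τ ↪ (Fin w → Bool)) :=
    Function.Embedding.nonempty_of_card_le (by simpa using h)
  have hlen : ∀ l : List τ, (l.flatMap fun x => List.ofFn (code x)).length = w * l.length := by
    intro l
    induction l with
    | nil => simp
    | cons a l ih => simp [ih]; ring
  have hinj : Function.Injective fun l : List τ => l.flatMap fun x => List.ofFn (code x) := by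
    intro l
    induction l with
    | nil =>
      intro l' h'
      have := congrArg List.length h'
      simp only [hlen, List.length_nil, mul_zero] at this
      have h0 : l'.length = 0 := by
        rcases Nat.mul_eq_zero.1 this.symm with h0 | h0
        · omega
        · exact h0
      exact (List.length_eq_zero_iff.1 h0).symm
    | cons a l ih =>
      intro l' h'
      cases l' with
      | nil =>
        have := congrArg List.length h'
        simp only [hlen, List.length_nil, mul_zero, List.length_cons] at this
        exfalso
        rcases Nat.mul_eq_zero.1 this with h0 | h0 <;> omega
      | cons b l' =>
        simp only [List.flatMap_cons] at h'
        obtain ⟨h1, h2⟩ := List.append_inj h' (by simp)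
        rw [code.injective (List.ofFn_injective h1), ih h2]
  refine ⟨fun S => S.toList.flatMap fun x => List.ofFn (code x),
    fun b => (Function.invFun (fun l : List τ => l.flatMap fun x => List.ofFn (code x)) b).toFinset,
    fun S => ?_, fun S => ?_⟩
  · have := Function.leftInverse_invFun hinj S.toList
    dsimp only at this ⊢
    rw [this, Finset.toList_toFinset]
  · dsimp only
    rw [hlen, Finset.length_toList]

/-- Virtual servers are assigned to `p` physical servers evenly. -/
lemma exists_balanced_host {α : Type*} [DecidableEq α] {p : ℕ} (hp : 0 < p) (V : Finset α) :
    ∃ host : α → Fin p, ∀ K : ℕ, V.card ≤ K * p →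
      ∀ s, (V.filter fun x => host x = s).card ≤ K := by
  classical
  let idx : α → ℕ := fun x => if h : x ∈ V then (V.equivFin ⟨x, h⟩).val else 0
  refine ⟨fun x => ⟨idx x % p, Nat.mod_lt _ hp⟩, fun K hK s => ?_⟩
  have : (V.filter fun x => (⟨idx x % p, Nat.mod_lt _ hp⟩ : Fin p) = s).card
      ≤ (Finset.range K).card := by
    refine Finset.card_le_card_of_injOn (fun x => idx x / p) ?_ ?_
    · intro x hx
      simp only [Finset.coe_filter, Set.mem_ofPred_eq] at hx
      have : idx x < V.card := by
        simp only [idx, dif_pos hx.1]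
        exact (V.equivFin ⟨x, hx.1⟩).2
      simp only [Finset.coe_range, Set.mem_Iio]
      exact Nat.div_lt_of_lt_mul (by linarith [mul_comm K p])
    · intro x hx y hy hxy
      simp only [Finset.coe_filter, Set.mem_ofPred_eq] at hx hy hxy
      have h1 : idx x % p = idx y % p := by
        have := congrArg Fin.val (hx.2.trans hy.2.symm)
        exact this
      have h2 : idx x = idx y := by
        rw [← Nat.div_add_mod (idx x) p, ← Nat.div_add_mod (idx y) p, h1, hxy]
      simp only [idx, dif_pos hx.1, dif_pos hy.1] at h2
      have := V.equivFin.injective (Fin.ext h2)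
      exact congrArg Subtype.val this
  simpa using this

end Encoding

/-! ### Two-round protocols given by routing predicates. -/

section Protocol

variable {k n p : ℕ}

/-- A tuple of an instance of the cycle query, tagged with the relation to which it belongs. -/
abbrev CycleFact (k n : ℕ) : Type := Fin k × (Fin 2 → Fin n)

/-- Degree statistics for the cycle query. -/
abbrev CycleStats (k n : ℕ) : Type := Fin k → Fin 2 → Fin n → ℕ

/-- The relations of an instance of the cycle query, as sets of pairs. -/
def cycleRel (I : (cycleQuery k).Instance n) (j : Fin k) : Finset (Fin 2 → Fin n) := I j

/-- The tuples of an instance, as a set of tagged tuples. -/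
def cycleFacts (I : (cycleQuery k).Instance n) : Finset (CycleFact k n) :=
  Finset.univ.filter fun x => x.2 ∈ cycleRel I x.1

/-- The `j`-th relation of a set of tagged tuples. -/
def relOfFacts (K : Finset (CycleFact k n)) (j : Fin k) : Finset (Fin 2 → Fin n) :=
  Finset.univ.filter fun t => (j, t) ∈ K

/-- The instance with a given set of tagged tuples. -/
def instanceOfFacts (K : Finset (CycleFact k n)) : (cycleQuery k).Instance n :=
  fun j => relOfFacts K j

lemma mem_cycleFacts {I : (cycleQuery k).Instance n} {x : CycleFact k n} :
    x ∈ cycleFacts I ↔ x.2 ∈ cycleRel I x.1 := by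
  simp [cycleFacts]

lemma mem_relOfFacts {K : Finset (CycleFact k n)} {j : Fin k} {t : Fin 2 → Fin n} :
    t ∈ relOfFacts K j ↔ (j, t) ∈ K := by
  simp [relOfFacts]

lemma mem_cycleRel_iff_of_partition {I : (cycleQuery k).Instance n}
    {F : Fin p → (cycleQuery k).Instance n} (hF : (cycleQuery k).IsUniformPartition I F)
    (j : Fin k) (t : Fin 2 → Fin n) : t ∈ cycleRel I j ↔ ∃ s, t ∈ cycleRel (F s) j :=
  hF.cover j t

/-- The facts that a server has received. -/
def knownFacts (dec : List Bool → Finset (CycleFact k n)) (h : MPCHistory p) :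
    Finset (CycleFact k n) :=
  h.foldr (fun f K => (Finset.univ.biUnion fun s => dec (f s)) ∪ K) ∅

open Classical in
/-- The two-round algorithm that sends encoded sets of input tuples: in the first round a server
sends each of its tuples `x` to the servers `s` with `route₁ x s`; in the second round a server
that knows the set `K` of tuples sends those chosen by `route₂ K`. In the end each server outputs
the answer on the tuples it has received. -/
noncomputable def twoRoundAlgorithm (Ω : Type) [Fintype Ω] [Nonempty Ω]
    (enc : Finset (CycleFact k n) → List Bool) (dec : List Bool → Finset (CycleFact k n))
    (route₁ : Ω → CycleStats k n → CycleFact k n → Fin p → Prop)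
    (route₂ : Ω → CycleStats k n → Finset (CycleFact k n) → Fin p → CycleFact k n → Fin p → Prop) :
    MPCAlgorithm (cycleQuery k) p n where
  Rand := Ω
  rounds := 2
  send ω D s F h s' :=
    match h with
    | [] => enc ((cycleFacts F).filter fun x => route₁ ω D x s')
    | _ :: _ => enc ((knownFacts dec h).filter fun x => route₂ ω D (knownFacts dec h) s x s')
  output _ _ _ _ h := (cycleQuery k).answer (instanceOfFacts (knownFacts dec h))

section TwoRound

variable {Ω : Type} {enc : Finset (CycleFact k n) → List Bool} {dec : List Bool → Finset (CycleFact k n)}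
  {route₁ : Ω → CycleStats k n → CycleFact k n → Fin p → Prop}
  {route₂ : Ω → CycleStats k n → Finset (CycleFact k n) → Fin p → CycleFact k n → Fin p → Prop}

open Classical in
/-- The facts known to server `s` after the first round. -/
noncomputable def factsAfterOne (route₁ : Ω → CycleStats k n → CycleFact k n → Fin p → Prop)
    (ω : Ω) (D : CycleStats k n) (I : (cycleQuery k).Instance n) (s : Fin p) :
    Finset (CycleFact k n) :=
  (cycleFacts I).filter fun x => route₁ ω D x s

open Classical in
/-- The facts that server `s'` sends to server `s` in the second round. -/
noncomputable def factsSentTwo (route₁ : Ω → CycleStats k n → CycleFact k n → Fin p → Prop)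
    (route₂ : Ω → CycleStats k n → Finset (CycleFact k n) → Fin p → CycleFact k n → Fin p → Prop)
    (ω : Ω) (D : CycleStats k n) (I : (cycleQuery k).Instance n) (s' s : Fin p) :
    Finset (CycleFact k n) :=
  (factsAfterOne route₁ ω D I s').filter
    fun x => route₂ ω D (factsAfterOne route₁ ω D I s') s' x s

variable {I : (cycleQuery k).Instance n} {F : Fin p → (cycleQuery k).Instance n}

lemma mem_factsAfterOne {ω : Ω} {D : CycleStats k n} {s : Fin p} {x : CycleFact k n} :
    x ∈ factsAfterOne route₁ ω D I s ↔ x.2 ∈ cycleRel I x.1 ∧ route₁ ω D x s := by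
  classical simp only [factsAfterOne, Finset.mem_filter, mem_cycleFacts]

lemma mem_factsSentTwo {ω : Ω} {D : CycleStats k n} {s s' : Fin p} {x : CycleFact k n} :
    x ∈ factsSentTwo route₁ route₂ ω D I s' s ↔ x ∈ factsAfterOne route₁ ω D I s' ∧
      route₂ ω D (factsAfterOne route₁ ω D I s') s' x s := by
  classical simp only [factsSentTwo, Finset.mem_filter]

variable [Fintype Ω] [Nonempty Ω]

/-- Servers use their own input only in the first round, so the partition `F` disappears from the
analysis from here on. -/
lemma knownFacts_history_one (hdec : ∀ S, dec (enc S) = S)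
    (hF : (cycleQuery k).IsUniformPartition I F) (ω : Ω) (D : CycleStats k n) (s : Fin p) :
    knownFacts dec ((twoRoundAlgorithm Ω enc dec route₁ route₂).history ω D F 1 s) =
      factsAfterOne route₁ ω D I s := by
  classical
  ext x
  simp only [MPCAlgorithm.history, twoRoundAlgorithm, List.nil_append, knownFacts, List.foldr_cons,
    List.foldr_nil, Finset.union_empty, Finset.mem_biUnion, Finset.mem_univ, true_and, hdec,
    Finset.mem_filter, mem_cycleFacts, factsAfterOne]
  rw [mem_cycleRel_iff_of_partition hF]
  simp

lemma history_one_ne_nil (ω : Ω) (D : CycleStats k n) (s : Fin p) :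
    ∃ f, (twoRoundAlgorithm Ω enc dec route₁ route₂).history ω D F 1 s = [f] := by
  exact ⟨_, rfl⟩

lemma send_round_two (hdec : ∀ S, dec (enc S) = S)
    (hF : (cycleQuery k).IsUniformPartition I F) (ω : Ω) (D : CycleStats k n) (s s' : Fin p) :
    (twoRoundAlgorithm Ω enc dec route₁ route₂).send ω D s' (F s')
      ((twoRoundAlgorithm Ω enc dec route₁ route₂).history ω D F 1 s') s =
      enc (factsSentTwo route₁ route₂ ω D I s' s) := by
  have h := knownFacts_history_one (route₁ := route₁) (route₂ := route₂) hdec hF ω D s'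
  obtain ⟨f, hf⟩ := history_one_ne_nil (enc := enc) (dec := dec) (route₁ := route₁)
    (route₂ := route₂) (F := F) ω D s'
  rw [hf] at h ⊢
  rw [factsSentTwo, ← h]
  rfl

lemma knownFacts_history_two (hdec : ∀ S, dec (enc S) = S)
    (hF : (cycleQuery k).IsUniformPartition I F) (ω : Ω) (D : CycleStats k n) (s : Fin p) :
    knownFacts dec ((twoRoundAlgorithm Ω enc dec route₁ route₂).history ω D F 2 s) =
      factsAfterOne route₁ ω D I s ∪
        Finset.univ.biUnion fun s' => factsSentTwo route₁ route₂ ω D I s' s := by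
  have h := knownFacts_history_one (route₁ := route₁) (route₂ := route₂) hdec hF ω D s
  obtain ⟨f, hf⟩ := history_one_ne_nil (enc := enc) (dec := dec) (route₁ := route₁)
    (route₂ := route₂) (F := F) ω D s
  have h2 : (twoRoundAlgorithm Ω enc dec route₁ route₂).history ω D F 2 s =
      (twoRoundAlgorithm Ω enc dec route₁ route₂).history ω D F 1 s ++ [fun s' =>
        (twoRoundAlgorithm Ω enc dec route₁ route₂).send ω D s' (F s')
          ((twoRoundAlgorithm Ω enc dec route₁ route₂).history ω D F 1 s') s] := rfl
  simp only [send_round_two hdec hF] at h2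
  rw [h2]
  rw [hf] at h ⊢
  simp only [knownFacts, List.foldr_cons, List.foldr_nil, Finset.union_empty, List.cons_append,
    List.nil_append, hdec] at h ⊢
  rw [h]

lemma received_zero {w : ℕ} (hlen : ∀ S, (enc S).length = w * S.card)
    (hF : (cycleQuery k).IsUniformPartition I F) (ω : Ω) (D : CycleStats k n) (s : Fin p) :
    (twoRoundAlgorithm Ω enc dec route₁ route₂).received ω D F 0 s =
      w * (factsAfterOne route₁ ω D I s).card := by
  classical
  have : factsAfterOne route₁ ω D I s =
      Finset.univ.biUnion fun s' => (cycleFacts (F s')).filter fun x => route₁ ω D x s := by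
    ext x
    simp only [factsAfterOne, Finset.mem_filter, mem_cycleFacts, Finset.mem_biUnion,
      Finset.mem_univ, true_and]
    rw [mem_cycleRel_iff_of_partition hF]
    simp
  rw [this, Finset.card_biUnion, Finset.mul_sum]
  · simp only [MPCAlgorithm.received, MPCAlgorithm.history, twoRoundAlgorithm, hlen]
  · intro s₁ _ s₂ _ h
    rw [Function.onFun, Finset.disjoint_left]
    intro x h1 h2
    simp only [Finset.mem_filter, mem_cycleFacts] at h1 h2
    exact Finset.disjoint_left.1 (hF.disjoint x.1 s₁ s₂ h) h1.1 h2.1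

lemma received_one {w : ℕ} (hdec : ∀ S, dec (enc S) = S)
    (hlen : ∀ S, (enc S).length = w * S.card)
    (hF : (cycleQuery k).IsUniformPartition I F) (ω : Ω) (D : CycleStats k n) (s : Fin p) :
    (twoRoundAlgorithm Ω enc dec route₁ route₂).received ω D F 1 s =
      w * ∑ s', (factsSentTwo route₁ route₂ ω D I s' s).card := by
  simp only [MPCAlgorithm.received, send_round_two hdec hF, hlen, Finset.mul_sum]

/-- The tuple of the `j`-th relation that an assignment of the variables uses. -/
def cycleEdge (t : Fin k → Fin n) (j : Fin k) : Fin 2 → Fin n :=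
  fun i => t ((cycleQuery k).var j i)

lemma mem_answer_iff {t : Fin k → Fin n} :
    t ∈ (cycleQuery k).answer I ↔ ∀ j, cycleEdge t j ∈ cycleRel I j := by
  rw [ConjQuery.answer, Finset.mem_filter]
  exact and_iff_right (Finset.mem_univ _)

lemma mem_answer_instanceOfFacts {K : Finset (CycleFact k n)} {t : Fin k → Fin n} :
    t ∈ (cycleQuery k).answer (instanceOfFacts K) ↔ ∀ j, (j, cycleEdge t j) ∈ K := by
  rw [mem_answer_iff]
  refine forall_congr' fun j => ?_
  exact mem_relOfFacts

/-- Soundness is automatic, because every fact received belongs to the instance; only the meeting of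
all edges of an answer at one server has to be assumed. -/
lemma twoRoundAlgorithm_result (hdec : ∀ S, dec (enc S) = S)
    (hF : (cycleQuery k).IsUniformPartition I F) (ω : Ω) (D : CycleStats k n)
    (h : ∀ t ∈ (cycleQuery k).answer I, ∃ s : Fin p, ∀ j,
      (j, cycleEdge t j) ∈ factsAfterOne route₁ ω D I s ∨
        ∃ s', (j, cycleEdge t j) ∈ factsSentTwo route₁ route₂ ω D I s' s) :
    (twoRoundAlgorithm Ω enc dec route₁ route₂).result ω D F = (cycleQuery k).answer I := by
  classical
  have hout : ∀ s, (twoRoundAlgorithm Ω enc dec route₁ route₂).output ω D s (F s)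
      ((twoRoundAlgorithm Ω enc dec route₁ route₂).history ω D F 2 s) =
      (cycleQuery k).answer (instanceOfFacts (factsAfterOne route₁ ω D I s ∪
        Finset.univ.biUnion fun s' => factsSentTwo route₁ route₂ ω D I s' s)) := by
    intro s
    rw [← knownFacts_history_two hdec hF]
    rfl
  ext t
  simp only [MPCAlgorithm.result, Finset.mem_biUnion, Finset.mem_univ, true_and]
  constructor
  · rintro ⟨s, hs⟩
    change t ∈ (twoRoundAlgorithm Ω enc dec route₁ route₂).output ω D s (F s)
      ((twoRoundAlgorithm Ω enc dec route₁ route₂).history ω D F 2 s) at hs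
    rw [hout, mem_answer_instanceOfFacts] at hs
    rw [mem_answer_iff]
    intro j
    have := hs j
    simp only [Finset.mem_union, mem_factsSentTwo, mem_factsAfterOne, Finset.mem_biUnion,
      Finset.mem_univ, true_and] at this
    rcases this with h | ⟨_, h, _⟩
    · exact h.1
    · exact h.1
  · intro ht
    obtain ⟨s, hs⟩ := h t ht
    refine ⟨s, ?_⟩
    change t ∈ (twoRoundAlgorithm Ω enc dec route₁ route₂).output ω D s (F s)
      ((twoRoundAlgorithm Ω enc dec route₁ route₂).history ω D F 2 s)
    rw [hout, mem_answer_instanceOfFacts]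
    intro j
    simpa using hs j

lemma twoRoundAlgorithm_maxLoad_le {w B : ℕ} (hdec : ∀ S, dec (enc S) = S)
    (hlen : ∀ S, (enc S).length = w * S.card)
    (hF : (cycleQuery k).IsUniformPartition I F) (ω : Ω) (D : CycleStats k n)
    (h1 : ∀ s, (factsAfterOne route₁ ω D I s).card ≤ B)
    (h2 : ∀ s, ∑ s', (factsSentTwo route₁ route₂ ω D I s' s).card ≤ B) :
    (twoRoundAlgorithm Ω enc dec route₁ route₂).maxLoad ω D F ≤ w * B := by
  refine Finset.sup_le fun r hr => Finset.sup_le fun s _ => ?_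
  have hr2 : r < 2 := Finset.mem_range.1 hr
  interval_cases r
  · rw [received_zero hlen hF]
    exact Nat.mul_le_mul_left _ (h1 s)
  · rw [received_one hdec hlen hF]
    exact Nat.mul_le_mul_left _ (h2 s)

end TwoRound

end Protocol

/-! ### The routing plan: heavy values, shares, cells and buckets. -/

section Plan

variable {k n p : ℕ}

/-- The variable that follows `x_j` on the cycle. -/
def nextVar (j : Fin k) : Fin k := ⟨(j.val + 1) % k, Nat.mod_lt _ j.pos⟩

/-- The variable that precedes `x_j` on the cycle. -/
def prevVar (j : Fin k) : Fin k := ⟨(j.val + (k - 1)) % k, Nat.mod_lt _ j.pos⟩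

lemma nextVar_prevVar (j : Fin k) : nextVar (prevVar j) = j := by
  have := j.2
  ext
  simp only [nextVar, prevVar, Nat.mod_add_mod]
  rw [show j.val + (k - 1) + 1 = j.val + k by omega, Nat.add_mod_right, Nat.mod_eq_of_lt j.2]

lemma prevVar_nextVar (j : Fin k) : prevVar (nextVar j) = j := by
  have := j.2
  ext
  simp only [nextVar, prevVar, Nat.mod_add_mod]
  rw [show j.val + 1 + (k - 1) = j.val + k by omega, Nat.add_mod_right, Nat.mod_eq_of_lt j.2]

lemma nextVar_ne (hk : 3 ≤ k) (j : Fin k) : j ≠ nextVar j := by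
  intro h
  have h1 := congrArg Fin.val h
  simp only [nextVar] at h1
  have := j.2
  rcases Nat.lt_or_ge (j.val + 1) k with h2 | h2
  · rw [Nat.mod_eq_of_lt h2] at h1; omega
  · rw [show j.val + 1 = k by omega, Nat.mod_self] at h1; omega

lemma cycleEdge_zero (t : Fin k → Fin n) (j : Fin k) : cycleEdge t j 0 = t j := rfl

lemma cycleEdge_one (t : Fin k → Fin n) (j : Fin k) : cycleEdge t j 1 = t (nextVar j) := rfl

/-- The range of the hash functions for grids of side `r`. -/
def hashRange (r : ℕ) : ℕ := r ^ 2 + r + 1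

instance (r : ℕ) : NeZero (hashRange r) := ⟨Nat.succ_ne_zero _⟩

/-- The hash functions, one for each variable. -/
abbrev Hashes (k n r : ℕ) : Type := Fin k → Fin n → Fin (hashRange r)

/-- A virtual server for joins: for each variable either a heavy value or a coordinate. -/
abbrev GridCell (k n r : ℕ) : Type := Fin k → Fin n ⊕ Fin (hashRange r)

/-- A virtual server for semijoins: a variable, a heavy value of the next variable, and a hash
value. -/
abbrev Bucket (k n r : ℕ) : Type := Fin k × Fin n × Fin (hashRange r)

namespace CycleStats

variable (D : CycleStats k n) (r m : ℕ)

/-- The value `v` of the variable `x_i` has degree at least `m / r`. -/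
def Heavy (i : Fin k) (v : Fin n) : Prop := m ≤ r * D i 0 v ∨ m ≤ r * D (prevVar i) 1 v

/-- The value `v` of the variable `x_i` has degree at most `m / r ^ 2` in the relation that
precedes it. -/
def Low (i : Fin k) (v : Fin n) : Prop := r ^ 2 * D (prevVar i) 1 v ≤ m

/-- The number of parts into which the values of the variable after `x_i` are hashed. -/
def share (i : Fin k) : Fin n ⊕ Fin (hashRange r) → ℕ
  | .inl h => r + D i 0 h * r ^ 2 / m
  | .inr _ => r

/-- The cell assigns to each variable a heavy value or a coordinate within its share. -/
def Valid (g : GridCell k n r) : Prop :=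
  ∀ i, (∀ h, g i = .inl h → D.Heavy r m i h) ∧
    ∀ c, g i = .inr c → c.val < D.share r m (prevVar i) (g (prevVar i))

variable {r}

open Classical in
/-- The coordinate of the value `v` of the variable `x_i`, when hashed into `s` parts. -/
noncomputable def coord (ω : Hashes k n r) (i : Fin k) (s : ℕ) (v : Fin n) :
    Fin n ⊕ Fin (hashRange r) :=
  if D.Heavy r m i v then .inl v
  else .inr ⟨(ω i v).val % s, (Nat.mod_le _ _).trans_lt (ω i v).2⟩

/-- The value `v` of the variable `x_i` belongs to the cell `g`. -/
def Fits (ω : Hashes k n r) (g : GridCell k n r) (i : Fin k) (v : Fin n) : Prop :=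
  g i = D.coord m ω i (D.share r m (prevVar i) (g (prevVar i))) v

variable (r)

/-- The tuples that undergo a semijoin before they are sent to the grid. -/
def Deferred (x : CycleFact k n) : Prop :=
  ¬ D.Heavy r m x.1 (x.2 0) ∧ D.Heavy r m (nextVar x.1) (x.2 1) ∧ D.Low r m x.1 (x.2 0)

open Classical in
/-- The virtual servers for joins. -/
noncomputable def cells : Finset (GridCell k n r) := Finset.univ.filter (D.Valid r m)

open Classical in
/-- The virtual servers for semijoins. -/
noncomputable def buckets : Finset (Bucket k n r) :=
  Finset.univ.filter fun b => D.Heavy r m (nextVar b.1) b.2.1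

/-- The server that simulates a cell. -/
noncomputable def cellHost (hp : 0 < p) : GridCell k n r → Fin p :=
  (exists_balanced_host hp (D.cells r m)).choose

/-- The server that simulates a bucket. -/
noncomputable def bucketHost (hp : 0 < p) : Bucket k n r → Fin p :=
  (exists_balanced_host hp (D.buckets r m)).choose

variable {r}

/-- The tuple `x` agrees with the cell `g`. -/
def FitsFact (ω : Hashes k n r) (g : GridCell k n r) (x : CycleFact k n) : Prop :=
  D.Fits m ω g x.1 (x.2 0) ∧ D.Fits m ω g (nextVar x.1) (x.2 1)

/-- The routing of the first round. -/
def routeOne (ω : Hashes k n r) (x : CycleFact k n) (s : Fin p) : Prop :=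
  (¬ D.Deferred r m x ∧ ∃ g ∈ D.cells r m, D.cellHost r m s.pos g = s ∧ D.FitsFact m ω g x) ∨
  (D.Deferred r m x ∧ D.bucketHost r m s.pos (x.1, x.2 1, ω x.1 (x.2 0)) = s) ∨
  (D.Low r m (nextVar x.1) (x.2 1) ∧ ∃ h, D.Heavy r m (nextVar (nextVar x.1)) h ∧
    D.bucketHost r m s.pos (nextVar x.1, h, ω (nextVar x.1) (x.2 1)) = s)

/-- The routing of the second round. -/
def routeTwo (ω : Hashes k n r) (K : Finset (CycleFact k n)) (s : Fin p) (x : CycleFact k n)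
    (s' : Fin p) : Prop :=
  D.Deferred r m x ∧ D.bucketHost r m s.pos (x.1, x.2 1, ω x.1 (x.2 0)) = s ∧
    ∃ g ∈ D.cells r m, D.cellHost r m s.pos g = s' ∧ D.FitsFact m ω g x ∧
      ∃ t, (prevVar x.1, t) ∈ K ∧ t 1 = x.2 0 ∧ D.Fits m ω g (prevVar x.1) (t 0)

end CycleStats

open CycleStats

variable {D : CycleStats k n} {r m : ℕ} {I : (cycleQuery k).Instance n}

/-- A share depends on the preceding coordinate only through its heavy value, if any, and not on the
modulus. This breaks the circular dependence of coordinates around the cycle. -/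
lemma share_coord (ω : Hashes k n r) (i : Fin k) (s s' : ℕ) (v : Fin n) :
    D.share r m i (D.coord m ω i s v) = D.share r m i (D.coord m ω i s' v) := by
  unfold coord
  split_ifs <;> rfl

lemma le_share (i : Fin k) (x : Fin n ⊕ Fin (hashRange r)) :
    r ≤ D.share r m i x := by
  cases x <;> simp [share]

lemma exists_cell (hr : 0 < r) (ω : Hashes k n r) (t : Fin k → Fin n) :
    ∃ g ∈ D.cells r m, ∀ i, D.Fits m ω g i (t i) := by
  classical
  -- The inner modulus `0` is a dummy, harmless by `share_coord`.
  let g : GridCell k n r := fun i =>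
    D.coord m ω i (D.share r m (prevVar i) (D.coord m ω (prevVar i) 0 (t (prevVar i)))) (t i)
  have hg : ∀ i, D.Fits m ω g i (t i) := by
    intro i
    simp only [Fits, g]
    congr 1
    exact share_coord _ _ _ _ _
  refine ⟨g, ?_, hg⟩
  simp only [cells, Finset.mem_filter, Finset.mem_univ, true_and]
  intro i
  have h := hg i
  simp only [Fits, coord] at h
  split_ifs at h with hh
  · refine ⟨fun v hv => ?_, fun c hc => ?_⟩
    · rw [h] at hv
      cases hv
      exact hh
    · rw [h] at hc
      cases hc
  · refine ⟨fun v hv => ?_, fun c hc => ?_⟩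
    · rw [h] at hv
      cases hv
    · rw [h] at hc
      cases hc
      exact Nat.mod_lt _ (hr.trans_le (le_share _ _))

lemma route_complete (hr : 0 < r) (hp : 0 < p) (ω : Hashes k n r) {t : Fin k → Fin n}
    (ht : t ∈ (cycleQuery k).answer I) :
    ∃ s : Fin p, ∀ j,
      (j, cycleEdge t j) ∈ factsAfterOne (fun ω D => CycleStats.routeOne D m ω) ω D I s ∨
        ∃ s', (j, cycleEdge t j) ∈ factsSentTwo (fun ω D => CycleStats.routeOne D m ω)
          (fun ω D => CycleStats.routeTwo D m ω) ω D I s' s := by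
  rw [mem_answer_iff] at ht
  obtain ⟨g, hg, hfit⟩ := exists_cell (D := D) (m := m) hr ω t
  refine ⟨D.cellHost r m hp g, fun j => ?_⟩
  have hF : D.FitsFact m ω g (j, cycleEdge t j) := ⟨hfit _, hfit _⟩
  by_cases hd : D.Deferred r m (j, cycleEdge t j)
  · right
    -- This bucket also receives the preceding edge of the answer as a probe, and that edge
    -- witnesses that the deferred tuple may be forwarded to the cell of the answer.
    refine ⟨D.bucketHost r m hp (j, t (nextVar j), ω j (t j)), ?_⟩
    rw [mem_factsSentTwo, mem_factsAfterOne]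
    refine ⟨⟨ht j, Or.inr (Or.inl ⟨hd, rfl⟩)⟩, hd, rfl, g, hg, rfl, hF,
      cycleEdge t (prevVar j),
      mem_factsAfterOne.2 ⟨ht _, Or.inr (Or.inr ?_)⟩, ?_, hfit _⟩
    · dsimp only
      rw [cycleEdge_one, nextVar_prevVar]
      exact ⟨hd.2.2, t (nextVar j), hd.2.1, rfl⟩
    · dsimp only
      rw [cycleEdge_one, nextVar_prevVar, cycleEdge_zero]
  · left
    rw [mem_factsAfterOne]
    exact ⟨ht j, Or.inl ⟨hd, g, hg, rfl, hF⟩⟩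

end Plan

/-! ### Degree estimates from the statistics and the numbers of virtual servers. -/

section Load

variable {k n p : ℕ}

/-- The degree of a value at a position of a relation. -/
def cycleDeg (I : (cycleQuery k).Instance n) (j : Fin k) (i : Fin 2) (v : Fin n) : ℕ :=
  ((cycleRel I j).filter fun t => t i = v).card

lemma sum_cycleDeg (I : (cycleQuery k).Instance n) (j : Fin k) (i : Fin 2) :
    ∑ v, cycleDeg I j i v = (cycleRel I j).card :=
  (Finset.card_eq_sum_card_fiberwise (f := fun t : Fin 2 → Fin n => t i) (t := Finset.univ)
    (fun _ _ => Finset.mem_coe.2 (Finset.mem_univ _))).symm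

/-- The statistics `D` determine the degrees in `I` up to `m / r ^ 3`, where `m` is the size of the
relations and at least `r ^ 3`. -/
structure CycleStats.IsFor (D : CycleStats k n) (r m : ℕ) (I : (cycleQuery k).Instance n) :
    Prop where
  card_eq : ∀ j, (cycleRel I j).card = m
  r_pos : 0 < r
  r_le : r ^ 3 ≤ m
  le_deg : ∀ j i v, D j i v ≤ cycleDeg I j i v
  deg_le : ∀ j i v, cycleDeg I j i v ≤ D j i v ∨ r ^ 3 * cycleDeg I j i v ≤ m

namespace CycleStats.IsFor

variable {D : CycleStats k n} {r m : ℕ} {I : (cycleQuery k).Instance n} (hD : D.IsFor r m I)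
include hD

lemma m_pos : 0 < m := (pow_pos hD.r_pos 3).trans_le hD.r_le

lemma one_le_load : (1 : ℝ) ≤ (m : ℝ) / r ^ 2 := by
  have hr : (0 : ℝ) < r := by exact_mod_cast hD.r_pos
  rw [le_div_iff₀ (by positivity), one_mul]
  exact_mod_cast (Nat.pow_le_pow_right hD.r_pos (by norm_num)).trans hD.r_le

lemma r_le_load : (r : ℝ) ≤ (m : ℝ) / r ^ 2 := by
  have hr : (0 : ℝ) < r := by exact_mod_cast hD.r_pos
  rw [le_div_iff₀ (by positivity)]
  have : r * r ^ 2 ≤ m := by rw [← pow_succ']; exact hD.r_le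
  exact_mod_cast this

lemma sum_stats_le (j : Fin k) (i : Fin 2) : ∑ v, D j i v ≤ m := by
  rw [← hD.card_eq j, ← sum_cycleDeg I j i]
  exact Finset.sum_le_sum fun v _ => hD.le_deg j i v

lemma stats_le (j : Fin k) (i : Fin 2) (v : Fin n) : D j i v ≤ m :=
  (Finset.single_le_sum (f := fun v => D j i v) (fun _ _ => Nat.zero_le _)
    (Finset.mem_univ v)).trans (hD.sum_stats_le j i)

/-- Degrees that the statistics underestimate are at most `m / r ^ 3`, below every threshold in use,
so tests on the statistics are valid for the true degrees. -/
lemma mul_deg_le_of_stats {j : Fin k} {i : Fin 2} {v : Fin n} {e : ℕ} (he : e ≤ 3)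
    (h : r ^ e * D j i v ≤ m) : r ^ e * cycleDeg I j i v ≤ m := by
  rcases hD.deg_le j i v with h' | h'
  · exact (Nat.mul_le_mul_left _ h').trans h
  · exact (Nat.mul_le_mul_right _ (Nat.pow_le_pow_right hD.r_pos he)).trans h'

lemma deg_le_of_not_heavy {i : Fin k} {v : Fin n} (h : ¬ D.Heavy r m i v) :
    (cycleDeg I i 0 v : ℝ) ≤ r * ((m : ℝ) / r ^ 2) ∧
      (cycleDeg I (prevVar i) 1 v : ℝ) ≤ r * ((m : ℝ) / r ^ 2) := by
  have hr : (0 : ℝ) < r := by exact_mod_cast hD.r_pos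
  simp only [CycleStats.Heavy, not_or, not_le] at h
  have h1 := hD.mul_deg_le_of_stats (e := 1) (by norm_num) (by rw [pow_one]; exact h.1.le)
  have h2 := hD.mul_deg_le_of_stats (e := 1) (by norm_num) (by rw [pow_one]; exact h.2.le)
  have e : (r : ℝ) * ((m : ℝ) / r ^ 2) = m / r := by field_simp
  rw [e, le_div_iff₀ hr, le_div_iff₀ hr, mul_comm _ (r : ℝ), mul_comm _ (r : ℝ)]
  rw [pow_one] at h1 h2
  exact ⟨by exact_mod_cast h1, by exact_mod_cast h2⟩

lemma deg_le_of_low {i : Fin k} {v : Fin n} (h : D.Low r m i v) :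
    (cycleDeg I (prevVar i) 1 v : ℝ) ≤ (m : ℝ) / r ^ 2 := by
  have hr : (0 : ℝ) < r := by exact_mod_cast hD.r_pos
  have h1 := hD.mul_deg_le_of_stats (e := 2) (by norm_num) h
  rw [le_div_iff₀ (by positivity), mul_comm]
  exact_mod_cast h1

lemma lt_deg_of_not_low {i : Fin k} {v : Fin n} (h : ¬ D.Low r m i v) :
    (m : ℝ) / r ^ 2 < (cycleDeg I (prevVar i) 1 v : ℝ) := by
  have hr : (0 : ℝ) < r := by exact_mod_cast hD.r_pos
  simp only [CycleStats.Low, not_le] at h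
  rw [div_lt_iff₀ (by positivity), mul_comm]
  have := h.trans_le (Nat.mul_le_mul_left (r ^ 2) (hD.le_deg (prevVar i) 1 v))
  exact_mod_cast this

lemma deg_le_share (i : Fin k) (h : Fin n) :
    (cycleDeg I i 0 h : ℝ) ≤ D.share r m i (.inl h) * ((m : ℝ) / r ^ 2) := by
  have hr : (0 : ℝ) < r := by exact_mod_cast hD.r_pos
  have hm := hD.m_pos
  have key : cycleDeg I i 0 h * r ^ 2 ≤ (r + D i 0 h * r ^ 2 / m) * m := by
    rcases hD.deg_le i 0 h with h' | h'
    · have h1 : D i 0 h * r ^ 2 ≤ (D i 0 h * r ^ 2 / m + 1) * m := by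
        have := Nat.lt_div_mul_add (a := D i 0 h * r ^ 2) hm
        linarith
      calc cycleDeg I i 0 h * r ^ 2 ≤ D i 0 h * r ^ 2 := Nat.mul_le_mul_right _ h'
        _ ≤ (D i 0 h * r ^ 2 / m + 1) * m := h1
        -- The summand `r ≥ 1` of the share absorbs the rounding of the quotient.
        _ ≤ _ := Nat.mul_le_mul_right _ (by linarith [hD.r_pos])
    · calc cycleDeg I i 0 h * r ^ 2 = r ^ 2 * cycleDeg I i 0 h := mul_comm _ _
        _ ≤ r ^ 3 * cycleDeg I i 0 h :=
            Nat.mul_le_mul_right _ (Nat.pow_le_pow_right hD.r_pos (by norm_num))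
        _ ≤ 1 * m := by linarith
        _ ≤ _ := Nat.mul_le_mul_right _ (by linarith [hD.r_pos, Nat.zero_le (D i 0 h * r ^ 2 / m)])
  rw [mul_div_assoc', le_div_iff₀ (by positivity)]
  simp only [CycleStats.share]
  exact_mod_cast key

lemma share_le (i : Fin k) (x : Fin n ⊕ Fin (hashRange r)) : D.share r m i x ≤ hashRange r := by
  cases x with
  | inl h =>
    have : D i 0 h * r ^ 2 / m ≤ r ^ 2 :=
      Nat.div_le_of_le_mul (Nat.mul_le_mul_right _ (hD.stats_le i 0 h))
    -- The largest share is `r + r ^ 2`, which `hashRange` accommodates.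
    simp only [CycleStats.share, hashRange]
    omega
  | inr c =>
    simp only [CycleStats.share, hashRange]
    omega

lemma mul_card_hash_eq_le (i : Fin k) (x : Fin n ⊕ Fin (hashRange r)) (a : ℕ) :
    (D.share r m i x : ℝ) *
      (Finset.univ.filter fun c : Fin (hashRange r) => c.val % D.share r m i x = a).card
      ≤ 2 * Fintype.card (Fin (hashRange r)) := by
  rw [Fintype.card_fin]
  exact_mod_cast mul_card_filter_mod_eq_le (hD.share_le i x) a

end CycleStats.IsFor

section Counting

open CycleStats

variable {D : CycleStats k n} {r m : ℕ} {I : (cycleQuery k).Instance n}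

open Classical in
lemma card_heavy_le (hD : D.IsFor r m I) (i : Fin k) :
    (Finset.univ.filter fun v => D.Heavy r m i v).card ≤ 2 * r := by
  have h : ∀ (j : Fin k) (c : Fin 2), (Finset.univ.filter fun v => m ≤ r * D j c v).card ≤ r := by
    intro j c
    have h1 : (Finset.univ.filter fun v => m ≤ r * D j c v).card * m ≤ r * m := by
      calc (Finset.univ.filter fun v => m ≤ r * D j c v).card * m
          = ∑ _v ∈ Finset.univ.filter fun v => m ≤ r * D j c v, m := by simp
        _ ≤ ∑ v ∈ Finset.univ.filter fun v => m ≤ r * D j c v, r * D j c v :=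
            Finset.sum_le_sum fun v hv => (Finset.mem_filter.1 hv).2
        _ ≤ ∑ v, r * D j c v := Finset.sum_le_sum_of_subset (Finset.filter_subset _ _)
        _ = r * ∑ v, D j c v := by rw [Finset.mul_sum]
        _ ≤ r * m := Nat.mul_le_mul_left _ (hD.sum_stats_le j c)
    exact Nat.le_of_mul_le_mul_right h1 hD.m_pos
  have : (Finset.univ.filter fun v => D.Heavy r m i v) =
      (Finset.univ.filter fun v => m ≤ r * D i 0 v) ∪
        (Finset.univ.filter fun v => m ≤ r * D (prevVar i) 1 v) := by
    ext v
    simp only [Finset.mem_union, Finset.mem_filter, Finset.mem_univ, true_and]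
    rfl
  rw [this]
  refine (Finset.card_union_le _ _).trans ?_
  linarith [h i 0, h (prevVar i) 1]

open Classical in
lemma card_buckets_le (hD : D.IsFor r m I) : (D.buckets r m).card ≤ 6 * k * r ^ 3 := by
  have h : D.buckets r m ⊆ Finset.univ.biUnion fun j : Fin k =>
      (Finset.univ.filter fun v => D.Heavy r m (nextVar j) v).biUnion fun v =>
        Finset.univ.image fun c => (j, v, c) := by
    rintro ⟨j, v, c⟩ hb
    simp only [CycleStats.buckets, Finset.mem_filter, Finset.mem_univ, true_and] at hb
    simp only [Finset.mem_biUnion, Finset.mem_univ, true_and, Finset.mem_filter, Finset.mem_image]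
    exact ⟨j, v, hb, c, rfl⟩
  calc (D.buckets r m).card ≤ _ := Finset.card_le_card h
    _ ≤ (Finset.univ : Finset (Fin k)).card * (2 * r * hashRange r) := by
        refine Finset.card_biUnion_le_card_mul _ _ _ fun j _ => ?_
        refine (Finset.card_biUnion_le_card_mul _ _ (hashRange r) fun v _ => ?_).trans
          (Nat.mul_le_mul_right _ (card_heavy_le hD _))
        exact Finset.card_image_le.trans (by simp)
    _ ≤ k * (2 * r * (3 * r ^ 2)) := by
        rw [Finset.card_univ, Fintype.card_fin]
        have := hD.r_pos
        gcongr
        simp only [hashRange]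
        nlinarith
    _ = _ := by ring

/-- The pattern of a cell: its heavy values. -/
def cellPattern {r : ℕ} (g : GridCell k n r) (i : Fin k) : Option (Fin n) := (g i).getLeft?

/-- The contribution of one variable to the number of cells, where a heavy value also accounts for
the increase of the share of the next variable. -/
noncomputable def patternWeight (D : CycleStats k n) (r m : ℕ) (i : Fin k) : Option (Fin n) → ℝ
  | none => r
  | some h => ((r + D i 0 h * r ^ 2 / m : ℕ) : ℝ) / r

-- There are at most `2 * r` heavy values with total degree at most `m`, so the numerators sum to at
-- most `2 * r ^ 2 + r ^ 2`. After division by `r` this is `3 * r`, and the light option adds `r`.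
open Classical in
lemma sum_patternWeight_le (hD : D.IsFor r m I) (i : Fin k) :
    ∑ x ∈ insert none ((Finset.univ.filter fun v => D.Heavy r m i v).image some),
      patternWeight D r m i x ≤ 4 * r := by
  have hr : (0 : ℝ) < r := by exact_mod_cast hD.r_pos
  have hm : (0 : ℝ) < m := by exact_mod_cast hD.m_pos
  rw [Finset.sum_insert (by simp), Finset.sum_image (fun a _ b _ h => Option.some.inj h)]
  simp only [patternWeight]
  rw [← Finset.sum_div]
  have h1 : ∑ v ∈ Finset.univ.filter fun v => D.Heavy r m i v,
      ((r + D i 0 v * r ^ 2 / m : ℕ) : ℝ) ≤ 3 * r ^ 2 := by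
    calc ∑ v ∈ Finset.univ.filter fun v => D.Heavy r m i v, ((r + D i 0 v * r ^ 2 / m : ℕ) : ℝ)
        ≤ ∑ v ∈ Finset.univ.filter fun v => D.Heavy r m i v, ((r : ℝ) + D i 0 v * (r ^ 2 / m)) := by
          refine Finset.sum_le_sum fun v _ => ?_
          push_cast
          gcongr
          refine Nat.cast_div_le.trans ?_
          push_cast
          rw [mul_div_assoc]
      _ = (Finset.univ.filter fun v => D.Heavy r m i v).card * (r : ℝ) +
          (∑ v ∈ Finset.univ.filter fun v => D.Heavy r m i v, (D i 0 v : ℝ)) * (r ^ 2 / m) := by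
          rw [Finset.sum_add_distrib, Finset.sum_mul]
          simp
      _ ≤ (2 * r : ℝ) * r + m * (r ^ 2 / m) := by
          gcongr
          · exact_mod_cast card_heavy_le hD i
          · have h2 : ∑ v ∈ Finset.univ.filter fun v => D.Heavy r m i v, D i 0 v ≤ m :=
              (Finset.sum_le_sum_of_subset (Finset.filter_subset _ _)).trans (hD.sum_stats_le i 0)
            exact_mod_cast h2
      _ = 3 * r ^ 2 := by field_simp; ring
  have : (∑ v ∈ Finset.univ.filter fun v => D.Heavy r m i v,
      ((r + D i 0 v * r ^ 2 / m : ℕ) : ℝ)) / r ≤ 3 * r := by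
    rw [div_le_iff₀ hr]; linarith
  linarith

-- With the heavy values fixed, a light variable has as many coordinates as the share set by its
-- predecessor. The excess factor `φ` of that share over `r` is charged to the predecessor, so that
-- the bound becomes a product of weights of single variables.
open Classical in
lemma card_cells_with_pattern_le (hr : 0 < r) (σ : Fin k → Option (Fin n)) :
    (((D.cells r m).filter fun g => cellPattern g = σ).card : ℝ) ≤
      ∏ i, patternWeight D r m i (σ i) := by
  have hr' : (0 : ℝ) < r := by exact_mod_cast hr
  let φ : Fin k → ℝ := fun i => match σ i with
    | none => 1
    | some h => ((r + D i 0 h * r ^ 2 / m : ℕ) : ℝ) / r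
  let N : Fin k → ℕ := fun i => match σ i with
    | none => r
    | some h => r + D i 0 h * r ^ 2 / m
  have hN : ∀ i, (N i : ℝ) = r * φ i := by
    intro i
    simp only [N, φ]
    cases σ i with
    | none => simp
    | some h => field_simp
  have hφ : ∀ i, 1 ≤ φ i := by
    intro i
    have h1 : (r : ℝ) ≤ N i := by
      have : r ≤ N i := by
        simp only [N]
        cases σ i <;> simp
      exact_mod_cast this
    rw [hN] at h1
    exact le_of_mul_le_mul_left (by linarith) hr'
  let S : Fin k → Finset (Fin n ⊕ Fin (hashRange r)) := fun i => match σ i with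
    | none => (Finset.univ.filter fun c : Fin (hashRange r) => c.val < N (prevVar i)).image .inr
    | some h => {.inl h}
  have hsub : ((D.cells r m).filter fun g => cellPattern g = σ) ⊆ Fintype.piFinset S := by
    intro g hg
    simp only [CycleStats.cells, Finset.mem_filter, Finset.mem_univ, true_and] at hg
    obtain ⟨hv, hp⟩ := hg
    rw [Fintype.mem_piFinset]
    intro i
    have hpi : ∀ i, σ i = (g i).getLeft? := fun i => (congrFun hp i).symm
    have hshare : D.share r m (prevVar i) (g (prevVar i)) = N (prevVar i) := by
      simp only [N, hpi]
      cases g (prevVar i) <;> rfl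
    have h2 := (hv i).2
    simp only [S, hpi]
    cases hgi : g i with
    | inl h => simp
    | inr c =>
      have := h2 c hgi
      rw [hshare] at this
      simpa using this
  have hS : ∀ i, ((S i).card : ℝ) ≤ (if σ i = none then (r : ℝ) else 1) * φ (prevVar i) := by
    intro i
    simp only [S]
    cases h : σ i with
    | none =>
      simp only [if_true]
      rw [← hN]
      have : ((Finset.univ.filter fun c : Fin (hashRange r) =>
          c.val < N (prevVar i)).image (Sum.inr : _ → Fin n ⊕ Fin (hashRange r))).card
          ≤ N (prevVar i) := by
        refine Finset.card_image_le.trans ?_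
        have := Finset.card_le_card_of_injOn (s := Finset.univ.filter
          fun c : Fin (hashRange r) => c.val < N (prevVar i)) (t := Finset.range (N (prevVar i)))
          (fun c => c.val) (fun c hc => by simpa using hc) (Fin.val_injective.injOn)
        simpa using this
      exact_mod_cast this
    | some v => simpa using hφ _
  -- Shifting around the cycle moves each excess factor to the variable that causes it.
  have hprev : ∏ i, φ (prevVar i) = ∏ i, φ i :=
    Equiv.prod_comp (⟨prevVar, nextVar, nextVar_prevVar, prevVar_nextVar⟩ : Fin k ≃ Fin k) φ
  calc (((D.cells r m).filter fun g => cellPattern g = σ).card : ℝ)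
      ≤ ((Fintype.piFinset S).card : ℝ) := by exact_mod_cast Finset.card_le_card hsub
    _ = ∏ i, ((S i).card : ℝ) := by rw [Fintype.card_piFinset]; push_cast; rfl
    _ ≤ ∏ i, ((if σ i = none then (r : ℝ) else 1) * φ (prevVar i)) :=
        Finset.prod_le_prod (fun _ _ => by positivity) fun i _ => hS i
    _ = ∏ i, ((if σ i = none then (r : ℝ) else 1) * φ i) := by
        rw [Finset.prod_mul_distrib, hprev, ← Finset.prod_mul_distrib]
    _ = _ := by
        refine Finset.prod_congr rfl fun i _ => ?_
        simp only [φ]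
        cases σ i <;> simp [patternWeight]

open Classical in
lemma card_cells_le (hD : D.IsFor r m I) : (D.cells r m).card ≤ (4 * r) ^ k := by
  have hr := hD.r_pos
  let S : Fin k → Finset (Option (Fin n)) := fun i =>
    insert none ((Finset.univ.filter fun v => D.Heavy r m i v).image some)
  have hmaps : ∀ g ∈ D.cells r m, cellPattern g ∈ Fintype.piFinset S := by
    intro g hg
    simp only [CycleStats.cells, Finset.mem_filter, Finset.mem_univ, true_and] at hg
    rw [Fintype.mem_piFinset]
    intro i
    have h1 := (hg i).1
    simp only [cellPattern, S]
    cases hgi : g i with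
    | inl h => simpa using h1 h hgi
    | inr c => simp
  have key : ((D.cells r m).card : ℝ) ≤ (4 * r) ^ k := by
    calc ((D.cells r m).card : ℝ)
        = ∑ σ ∈ Fintype.piFinset S, (((D.cells r m).filter fun g => cellPattern g = σ).card : ℝ) := by
          exact_mod_cast Finset.card_eq_sum_card_fiberwise hmaps
      _ ≤ ∑ σ ∈ Fintype.piFinset S, ∏ i, patternWeight D r m i (σ i) :=
          Finset.sum_le_sum fun σ _ => card_cells_with_pattern_le hr σ
      _ = ∏ i, ∑ x ∈ S i, patternWeight D r m i x := (Finset.prod_univ_sum _ _).symm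
      _ ≤ ∏ _i : Fin k, (4 * r : ℝ) := by
          refine Finset.prod_le_prod (fun i _ => Finset.sum_nonneg fun x _ => ?_)
            fun i _ => sum_patternWeight_le hD i
          cases x <;> simp only [patternWeight] <;> positivity
      _ = (4 * r) ^ k := by simp
  exact_mod_cast key

end Counting

end Load

/-! ### Loads of cells and buckets, and their transfer to the physical servers. -/

section LoadBounds

open CycleStats

variable {k n p : ℕ}

section Defs

variable (D : CycleStats k n) (m : ℕ) (I : (cycleQuery k).Instance n) {r : ℕ}

open Classical in
/-- The tuples of the `j`-th relation that are sent directly to the cell `g`. -/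
noncomputable def cellLoad (g : GridCell k n r) (j : Fin k) (ω : Hashes k n r) :
    Finset (Fin 2 → Fin n) :=
  (cycleRel I j).filter fun t => ¬ D.Deferred r m (j, t) ∧ D.FitsFact m ω g (j, t)

/-- The deferred tuples that are sent to a bucket. -/
def deferredLoad (b : Bucket k n r) (ω : Hashes k n r) : Finset (Fin 2 → Fin n) :=
  (cycleRel I b.1).filter fun t => t 1 = b.2.1 ∧ ω b.1 (t 0) = b.2.2

open Classical in
/-- The tuples that are sent to a bucket in order to be matched with deferred tuples. -/
noncomputable def probeLoad (b : Bucket k n r) (ω : Hashes k n r) : Finset (Fin 2 → Fin n) :=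
  (cycleRel I (prevVar b.1)).filter fun t => D.Low r m b.1 (t 1) ∧ ω b.1 (t 1) = b.2.2

/-- Every virtual server receives at most `T` tuples of each kind. -/
structure LoadsLE (T : ℝ) (ω : Hashes k n r) : Prop where
  cell : ∀ g ∈ D.cells r m, ∀ j, ((cellLoad D m I g j ω).card : ℝ) ≤ T
  deferred : ∀ b ∈ D.buckets r m, ((deferredLoad I b ω).card : ℝ) ≤ T
  probe : ∀ b ∈ D.buckets r m, ((probeLoad D m I b ω).card : ℝ) ≤ T

end Defs

variable {D : CycleStats k n} {r m : ℕ} {I : (cycleQuery k).Instance n}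

lemma Fits_inl {ω : Hashes k n r} {g : GridCell k n r} {i : Fin k} {v h : Fin n}
    (hg : g i = .inl h) (hf : D.Fits m ω g i v) : v = h ∧ D.Heavy r m i v := by
  rw [Fits, hg, coord] at hf
  split_ifs at hf with hh
  exact ⟨(Sum.inl.inj hf).symm, hh⟩

lemma Fits_inr {ω : Hashes k n r} {g : GridCell k n r} {i : Fin k} {v : Fin n}
    {c : Fin (hashRange r)} (hg : g i = .inr c) (hf : D.Fits m ω g i v) :
    ¬ D.Heavy r m i v ∧ (ω i v).val % D.share r m (prevVar i) (g (prevVar i)) = c.val := by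
  rw [Fits, hg, coord] at hf
  split_ifs at hf with hh
  exact ⟨hh, (congrArg Fin.val (Sum.inr.inj hf)).symm⟩

lemma pair_ext {t t' : Fin 2 → Fin n} (h0 : t 0 = t' 0) (h1 : t 1 = t' 1) : t = t' := by
  ext i
  fin_cases i
  · exact congrArg Fin.val h0
  · exact congrArg Fin.val h1

lemma mem_cellLoad {g : GridCell k n r} {j : Fin k} {ω : Hashes k n r} {t : Fin 2 → Fin n} :
    t ∈ cellLoad D m I g j ω ↔
      t ∈ cycleRel I j ∧ ¬ D.Deferred r m (j, t) ∧ D.FitsFact m ω g (j, t) := by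
  classical simp only [cellLoad, Finset.mem_filter]

lemma mem_probeLoad {b : Bucket k n r} {ω : Hashes k n r} {t : Fin 2 → Fin n} :
    t ∈ probeLoad D m I b ω ↔
      t ∈ cycleRel I (prevVar b.1) ∧ D.Low r m b.1 (t 1) ∧ ω b.1 (t 1) = b.2.2 := by
  classical simp only [probeLoad, Finset.mem_filter]

lemma chernoff_threshold_le {t L : ℝ} (ht : 0 ≤ t) (hL : 0 ≤ L) :
    (2 + t) * (2 * L) ≤ (2 + t) ^ 2 * (4 * L) := by
  nlinarith [mul_nonneg ht hL, mul_nonneg (mul_nonneg ht ht) hL]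

lemma unifProb_cellLoad_le (hk : 3 ≤ k) (hD : D.IsFor r m I) (g : GridCell k n r) (j : Fin k)
    {t : ℝ} (ht : 0 ≤ t) :
    unifProb (fun ω : Hashes k n r => (2 + t) ^ 2 * (4 * ((m : ℝ) / r ^ 2)) <
      ((cellLoad D m I g j ω).card : ℝ)) ≤ ((r : ℝ) ^ 2 + 2) * Real.exp (-t) := by
  classical
  have hr : (1 : ℝ) ≤ r := by exact_mod_cast hD.r_pos
  have hL := hD.one_le_load
  have hrL := hD.r_le_load
  have hexp := Real.exp_pos (-t)
  have hmL : (m : ℝ) = r ^ 2 * ((m : ℝ) / r ^ 2) := by field_simp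
  have hcard : ((cycleRel I j).card : ℝ) = r ^ 2 * ((m : ℝ) / r ^ 2) := by
    rw [hD.card_eq j]; exact hmL
  set L : ℝ := (m : ℝ) / r ^ 2 with hLdef
  have hβ : (0 : ℝ) < Fintype.card (Fin (hashRange r)) := by exact_mod_cast Fintype.card_pos
  have hone : Real.exp (-t) ≤ ((r : ℝ) ^ 2 + 2) * Real.exp (-t) := by nlinarith
  have hT : (2 + t) * (2 * L) ≤ (2 + t) ^ 2 * (4 * L) := chernoff_threshold_le ht (by linarith)
  have hsh : ∀ i x, (r : ℝ) ≤ D.share r m i x := fun i x => by exact_mod_cast le_share i x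
  have hA := fun a => hD.mul_card_hash_eq_le (prevVar j) (g (prevVar j)) a
  have hB := fun a => hD.mul_card_hash_eq_le j (g j) a
  cases hg0 : g j with
  | inl h =>
    cases hg1 : g (nextVar j) with
    | inl h' =>
      refine (le_of_eq ?_).trans (hexp.le.trans hone)
      rw [← unifProb_false (Ω := Hashes k n r)]
      congr 1
      funext ω
      rw [eq_iff_iff, iff_false, not_lt]
      have : (cellLoad D m I g j ω).card ≤ 1 := by
        rw [Finset.card_le_one]
        intro x hx y hy
        rw [mem_cellLoad] at hx hy
        exact pair_ext ((Fits_inl hg0 hx.2.2.1).1.trans (Fits_inl hg0 hy.2.2.1).1.symm)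
          ((Fits_inl hg1 hx.2.2.2).1.trans (Fits_inl hg1 hy.2.2.2).1.symm)
      have h1 : ((cellLoad D m I g j ω).card : ℝ) ≤ 1 := by exact_mod_cast this
      nlinarith [mul_nonneg ht (zero_le_one.trans hL)]
    -- Heavy then light: the `cycleDeg I j 0 h` tuples have distinct second values, hashed into a
    -- share of at least `cycleDeg I j 0 h / L` parts.
    | inr c =>
      refine le_trans ?_ hone
      refine unifProb_load_le_of_coord (nextVar j) ((cycleRel I j).filter fun x => x 0 = h)
        (fun x => x 1)
        (Finset.univ.filter fun b : Fin (hashRange r) => b.val % D.share r m j (g j) = c.val)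
        hT ?_ (by positivity) (fun v => ?_) ?_
      · intro ω x hx
        rw [mem_cellLoad] at hx
        have h2 := (Fits_inr hg1 hx.2.2.2).2
        rw [prevVar_nextVar] at h2
        simp only [Finset.mem_filter, Finset.mem_univ, true_and]
        exact ⟨⟨hx.1, (Fits_inl hg0 hx.2.2.1).1⟩, h2⟩
      · have : (((cycleRel I j).filter fun x => x 0 = h).filter fun x => x 1 = v).card ≤ 1 := by
          rw [Finset.card_le_one]
          intro x hx y hy
          simp only [Finset.mem_filter] at hx hy
          exact pair_ext (hx.1.2.trans hy.1.2.symm) (hx.2.trans hy.2.symm)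
        have h1 : ((((cycleRel I j).filter fun x => x 0 = h).filter fun x => x 1 = v).card : ℝ)
            ≤ 1 := by exact_mod_cast this
        linarith
      · have h1 := hD.deg_le_share j h
        have h2 := hB c.val
        rw [hg0] at h2 ⊢
        calc _ ≤ (D.share r m j (.inl h) * L) * _ := mul_le_mul_of_nonneg_right h1 (Nat.cast_nonneg _)
          _ = L * _ := by rw [mul_comm (D.share r m j (.inl h) : ℝ) L, mul_assoc]
          _ ≤ L * (2 * Fintype.card (Fin (hashRange r))) :=
              mul_le_mul_of_nonneg_left h2 (by linarith)
          _ = _ := by ring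
  | inr a =>
    cases hg1 : g (nextVar j) with
    -- Light then heavy: tuples that are not deferred have a first value that is not low, and the
    -- second value is fixed to `h'`.
    | inl h' =>
      refine le_trans ?_ hone
      refine unifProb_load_le_of_coord j
        ((cycleRel I j).filter fun x => x 1 = h' ∧ ¬ D.Low r m j (x 0)) (fun x => x 0)
        (Finset.univ.filter fun b : Fin (hashRange r) =>
          b.val % D.share r m (prevVar j) (g (prevVar j)) = a.val)
        hT ?_ (by positivity) (fun v => ?_) ?_
      · intro ω x hx
        rw [mem_cellLoad] at hx
        have h1 := Fits_inl hg1 hx.2.2.2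
        have h2 := Fits_inr hg0 hx.2.2.1
        simp only [Finset.mem_filter, Finset.mem_univ, true_and]
        exact ⟨⟨hx.1, h1.1, fun hlow => hx.2.1 ⟨h2.1, h1.2, hlow⟩⟩, h2.2⟩
      · have : (((cycleRel I j).filter fun x => x 1 = h' ∧ ¬ D.Low r m j (x 0)).filter
            fun x => x 0 = v).card ≤ 1 := by
          rw [Finset.card_le_one]
          intro x hx y hy
          simp only [Finset.mem_filter] at hx hy
          exact pair_ext (hx.2.trans hy.2.symm) (hx.1.2.1.trans hy.1.2.1.symm)
        have h1 : ((((cycleRel I j).filter fun x => x 1 = h' ∧ ¬ D.Low r m j (x 0)).filter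
            fun x => x 0 = v).card : ℝ) ≤ 1 := by exact_mod_cast this
        linarith
      -- At most `r ^ 2` values exceed degree `L` in the preceding relation. Hashing into at least
      -- `r` parts leaves a mean of at most `2 * r`, and `r ≤ L` because `r ^ 3 ≤ m`.
      · have h1 : (((cycleRel I j).filter fun x => x 1 = h' ∧ ¬ D.Low r m j (x 0)).card : ℝ)
            ≤ (r : ℝ) ^ 2 := by
          have h3 := card_large_fibers_le (cycleRel I (prevVar j)) (fun x : Fin 2 → Fin n => x 1)
            (d := L) (c := (r : ℝ) ^ 2) (by linarith)
            (by rw [hD.card_eq (prevVar j)]; exact hmL.le)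
          refine le_trans ?_ h3
          have h4 : ((cycleRel I j).filter fun x => x 1 = h' ∧ ¬ D.Low r m j (x 0)).card ≤
              (Finset.univ.filter fun v : Fin n =>
                L < (((cycleRel I (prevVar j)).filter fun x => x 1 = v).card : ℝ)).card := by
            refine Finset.card_le_card_of_injOn (fun x => x 0) ?_ ?_
            · intro x hx
              simp only [Finset.coe_filter, Set.mem_ofPred_eq, Finset.mem_univ, true_and] at hx ⊢
              exact hD.lt_deg_of_not_low hx.2.2
            · intro x hx y hy hxy
              simp only [Finset.coe_filter, Set.mem_ofPred_eq] at hx hy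
              exact pair_ext hxy (hx.2.1.trans hy.2.1.symm)
          exact_mod_cast h4
        have h2 := hA a.val
        have h5 := hsh (prevVar j) (g (prevVar j))
        calc _ ≤ (r : ℝ) ^ 2 * _ := mul_le_mul_of_nonneg_right h1 (Nat.cast_nonneg _)
          _ = r * (r * _) := by rw [pow_two, mul_assoc]
          _ ≤ L * (2 * Fintype.card (Fin (hashRange r))) := by
              refine mul_le_mul hrL (le_trans ?_ h2)
                (mul_nonneg (Nat.cast_nonneg _) (Nat.cast_nonneg _)) (by linarith)
              exact mul_le_mul_of_nonneg_right h5 (Nat.cast_nonneg _)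
          _ = _ := by ring
    -- Light on both sides: all degrees are at most `m / r = r * L`, and each of the two shares is
    -- at least `r`.
    | inr c =>
      refine unifProb_load_le_of_pair (nextVar_ne hk j)
        ((cycleRel I j).filter fun x => ¬ D.Heavy r m j (x 0) ∧ ¬ D.Heavy r m (nextVar j) (x 1))
        (fun x => x 0) (fun x => x 1) (fun x _ y _ h0 h1 => pair_ext h0 h1)
        (Finset.univ.filter fun b : Fin (hashRange r) =>
          b.val % D.share r m (prevVar j) (g (prevVar j)) = a.val)
        (Finset.univ.filter fun b : Fin (hashRange r) => b.val % D.share r m j (g j) = c.val)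
        ?_ hL hr ht ?_ (fun v => ?_) (fun v => ?_) ?_ ?_
      · intro ω x hx
        rw [mem_cellLoad] at hx
        have h1 := Fits_inr hg1 hx.2.2.2
        have h2 := Fits_inr hg0 hx.2.2.1
        have h3 := h1.2
        rw [prevVar_nextVar] at h3
        simp only [Finset.mem_filter, Finset.mem_univ, true_and]
        exact ⟨⟨hx.1, h2.1, h1.1⟩, h2.2, h3⟩
      · rw [← hcard]
        exact_mod_cast Finset.card_le_card (Finset.filter_subset _ _)
      · by_cases hv : D.Heavy r m j v
        · rw [Finset.filter_eq_empty_iff.2]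
          · simp only [Finset.card_empty, Nat.cast_zero]; positivity
          · intro x hx hxv
            rw [Finset.mem_filter, hxv] at hx
            exact hx.2.1 hv
        · refine le_trans ?_ (hD.deg_le_of_not_heavy hv).1
          exact_mod_cast Finset.card_le_card
            (Finset.filter_subset_filter _ (Finset.filter_subset _ _))
      · by_cases hv : D.Heavy r m (nextVar j) v
        · rw [Finset.filter_eq_empty_iff.2]
          · simp only [Finset.card_empty, Nat.cast_zero]; positivity
          · intro x hx hxv
            rw [Finset.mem_filter, hxv] at hx
            exact hx.2.2 hv
        · have h1 := (hD.deg_le_of_not_heavy hv).2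
          rw [prevVar_nextVar] at h1
          refine le_trans ?_ h1
          exact_mod_cast Finset.card_le_card
            (Finset.filter_subset_filter _ (Finset.filter_subset _ _))
      · refine le_trans ?_ (hA a.val)
        exact mul_le_mul_of_nonneg_right (hsh _ _) (Nat.cast_nonneg _)
      · refine le_trans ?_ (hB c.val)
        exact mul_le_mul_of_nonneg_right (hsh _ _) (Nat.cast_nonneg _)

/-- The second value being fixed, at most `m` distinct first values are spread over `hashRange r ≥ r
^ 2` hash values. -/
lemma unifProb_deferredLoad_le (hD : D.IsFor r m I) (b : Bucket k n r) {t : ℝ} (ht : 0 ≤ t) :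
    unifProb (fun ω : Hashes k n r => (2 + t) ^ 2 * (4 * ((m : ℝ) / r ^ 2)) <
      ((deferredLoad I b ω).card : ℝ)) ≤ Real.exp (-t) := by
  classical
  have hr : (0 : ℝ) < r := by exact_mod_cast hD.r_pos
  have hL := hD.one_le_load
  have hmL : (m : ℝ) = (m : ℝ) / r ^ 2 * r ^ 2 := by field_simp
  set L : ℝ := (m : ℝ) / r ^ 2 with hLdef
  have hT : (2 + t) * (2 * L) ≤ (2 + t) ^ 2 * (4 * L) := chernoff_threshold_le ht (by linarith)
  refine unifProb_load_le_of_coord b.1 ((cycleRel I b.1).filter fun x => x 1 = b.2.1)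
    (fun x => x 0) {b.2.2} hT ?_ (by positivity) (fun v => ?_) ?_
  · intro ω x hx
    simp only [deferredLoad, Finset.mem_filter] at hx
    simp only [Finset.mem_filter, Finset.mem_singleton]
    exact ⟨⟨hx.1, hx.2.1⟩, hx.2.2⟩
  · have : (((cycleRel I b.1).filter fun x => x 1 = b.2.1).filter fun x => x 0 = v).card ≤ 1 := by
      rw [Finset.card_le_one]
      intro x hx y hy
      simp only [Finset.mem_filter] at hx hy
      exact pair_ext (hx.2.trans hy.2.symm) (hx.1.2.trans hy.1.2.symm)
    have h1 : ((((cycleRel I b.1).filter fun x => x 1 = b.2.1).filter fun x => x 0 = v).card : ℝ)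
        ≤ 1 := by exact_mod_cast this
    linarith
  · rw [Finset.card_singleton, Nat.cast_one, mul_one, Fintype.card_fin]
    have h1 : (((cycleRel I b.1).filter fun x => x 1 = b.2.1).card : ℝ) ≤ m := by
      rw [← hD.card_eq b.1]
      exact_mod_cast Finset.card_le_card (Finset.filter_subset _ _)
    refine h1.trans (hmL.le.trans ?_)
    have h2 : (r : ℝ) ^ 2 ≤ (hashRange r : ℝ) := by
      rw [hashRange]; push_cast; linarith
    nlinarith

/-- Restricting the probes to low values is what bounds the weight of each hashed key by `L`. -/
lemma unifProb_probeLoad_le (hD : D.IsFor r m I) (b : Bucket k n r) {t : ℝ} (ht : 0 ≤ t) :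
    unifProb (fun ω : Hashes k n r => (2 + t) ^ 2 * (4 * ((m : ℝ) / r ^ 2)) <
      ((probeLoad D m I b ω).card : ℝ)) ≤ Real.exp (-t) := by
  classical
  have hr : (0 : ℝ) < r := by exact_mod_cast hD.r_pos
  have hL := hD.one_le_load
  have hmL : (m : ℝ) = (m : ℝ) / r ^ 2 * r ^ 2 := by field_simp
  have hlow := fun v => hD.deg_le_of_low (i := b.1) (v := v)
  set L : ℝ := (m : ℝ) / r ^ 2 with hLdef
  have hT : (2 + t) * (2 * L) ≤ (2 + t) ^ 2 * (4 * L) := chernoff_threshold_le ht (by linarith)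
  refine unifProb_load_le_of_coord b.1
    ((cycleRel I (prevVar b.1)).filter fun x => D.Low r m b.1 (x 1)) (fun x => x 1) {b.2.2} hT ?_
    (by positivity) (fun v => ?_) ?_
  · intro ω x hx
    rw [mem_probeLoad] at hx
    simp only [Finset.mem_filter, Finset.mem_singleton]
    exact ⟨⟨hx.1, hx.2.1⟩, hx.2.2⟩
  · by_cases hv : D.Low r m b.1 v
    · refine le_trans ?_ ((hlow v hv).trans (by linarith))
      exact_mod_cast Finset.card_le_card
        (Finset.filter_subset_filter _ (Finset.filter_subset _ _))
    · rw [Finset.filter_eq_empty_iff.2]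
      · simp only [Finset.card_empty, Nat.cast_zero]; positivity
      · intro x hx hxv
        rw [Finset.mem_filter, hxv] at hx
        exact hv hx.2
  · rw [Finset.card_singleton, Nat.cast_one, mul_one, Fintype.card_fin]
    have h1 : (((cycleRel I (prevVar b.1)).filter fun x => D.Low r m b.1 (x 1)).card : ℝ) ≤ m := by
      rw [← hD.card_eq (prevVar b.1)]
      exact_mod_cast Finset.card_le_card (Finset.filter_subset _ _)
    refine h1.trans (hmL.le.trans ?_)
    have h2 : (r : ℝ) ^ 2 ≤ (hashRange r : ℝ) := by
      rw [hashRange]; push_cast; linarith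
    nlinarith

lemma unifProb_not_loadsLE_le (hk : 3 ≤ k) (hD : D.IsFor r m I) {t : ℝ} (ht : 0 ≤ t)
    (hrp : r ^ k ≤ p) :
    unifProb (fun ω : Hashes k n r => ¬ LoadsLE D m I ((2 + t) ^ 2 * (4 * ((m : ℝ) / r ^ 2))) ω) ≤
      (3 * k * 4 ^ k + 12 * k) * (p : ℝ) ^ 2 * Real.exp (-t) := by
  set T : ℝ := (2 + t) ^ 2 * (4 * ((m : ℝ) / r ^ 2)) with hT
  have hexp := Real.exp_pos (-t)
  have hr1 := hD.r_pos
  have hr3 : r ^ 3 ≤ p := (Nat.pow_le_pow_right hr1 hk).trans hrp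
  have hr2 : r ^ 2 ≤ p := (Nat.pow_le_pow_right hr1 (by norm_num)).trans hr3
  have hp1 : 1 ≤ p := (Nat.one_le_pow _ _ hr1).trans hr3
  have hp1' : (1 : ℝ) ≤ p := by exact_mod_cast hp1
  have hcells : ((D.cells r m).card : ℝ) ≤ 4 ^ k * p := by
    have h := card_cells_le hD
    rw [mul_pow] at h
    exact_mod_cast h.trans (Nat.mul_le_mul_left _ hrp)
  have hbuckets : ((D.buckets r m).card : ℝ) ≤ 6 * k * p := by
    exact_mod_cast (card_buckets_le hD).trans (Nat.mul_le_mul_left _ hr3)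
  have hr2' : (r : ℝ) ^ 2 + 2 ≤ 3 * p := by
    have : (r : ℝ) ^ 2 ≤ p := by exact_mod_cast hr2
    linarith
  calc _ ≤ unifProb (fun ω : Hashes k n r =>
        (∃ g ∈ D.cells r m, ∃ j ∈ Finset.univ, T < ((cellLoad D m I g j ω).card : ℝ)) ∨
        ((∃ b ∈ D.buckets r m, T < ((deferredLoad I b ω).card : ℝ)) ∨
          ∃ b ∈ D.buckets r m, T < ((probeLoad D m I b ω).card : ℝ))) := by
        refine unifProb_mono fun ω h => ?_
        by_contra hcon
        push Not at hcon
        exact h ⟨fun g hg j => hcon.1 g hg j (Finset.mem_univ j), hcon.2.1, hcon.2.2⟩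
    _ ≤ (D.cells r m).card * (k * ((3 * p) * Real.exp (-t))) +
        ((D.buckets r m).card * Real.exp (-t) + (D.buckets r m).card * Real.exp (-t)) := by
        refine (unifProb_or_le _ _).trans (add_le_add ?_ ((unifProb_or_le _ _).trans
          (add_le_add ?_ ?_)))
        · refine (unifProb_exists_le _ _).trans ?_
          rw [← nsmul_eq_mul (D.cells r m).card, ← Finset.sum_const]
          refine Finset.sum_le_sum fun g _ => (unifProb_exists_le _ _).trans ?_
          have : (k : ℝ) * ((3 * p) * Real.exp (-t)) =
              ∑ _j : Fin k, (3 * p : ℝ) * Real.exp (-t) := by simp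
          rw [this]
          refine Finset.sum_le_sum fun j _ => (unifProb_cellLoad_le hk hD g j ht).trans ?_
          gcongr
        · refine (unifProb_exists_le _ _).trans ?_
          rw [← nsmul_eq_mul, ← Finset.sum_const]
          exact Finset.sum_le_sum fun b _ => unifProb_deferredLoad_le hD b ht
        · refine (unifProb_exists_le _ _).trans ?_
          rw [← nsmul_eq_mul, ← Finset.sum_const]
          exact Finset.sum_le_sum fun b _ => unifProb_probeLoad_le hD b ht
    _ ≤ (4 ^ k * p) * (k * ((3 * p) * Real.exp (-t))) +
        ((6 * k * p) * Real.exp (-t) + (6 * k * p) * Real.exp (-t)) := by gcongr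
    _ = 3 * k * 4 ^ k * (p : ℝ) ^ 2 * Real.exp (-t) + 12 * k * (p * 1) * Real.exp (-t) := by ring
    _ ≤ 3 * k * 4 ^ k * (p : ℝ) ^ 2 * Real.exp (-t) + 12 * k * (p * p) * Real.exp (-t) := by
        gcongr
    _ = _ := by ring

section Hosts

variable {T : ℝ} {ω : Hashes k n r}

lemma card_cellHost_fiber_le (hD : D.IsFor r m I) (hp : 0 < p) (hrp : r ^ k ≤ p) (s : Fin p) :
    ((D.cells r m).filter fun g => D.cellHost r m hp g = s).card ≤ 4 ^ k := by
  refine (exists_balanced_host hp (D.cells r m)).choose_spec (4 ^ k) ?_ s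
  have h := card_cells_le hD
  rw [mul_pow] at h
  exact h.trans (Nat.mul_le_mul_left _ hrp)

lemma card_bucketHost_fiber_le (hk : 3 ≤ k) (hD : D.IsFor r m I) (hp : 0 < p) (hrp : r ^ k ≤ p)
    (s : Fin p) :
    ((D.buckets r m).filter fun b => D.bucketHost r m hp b = s).card ≤ 6 * k :=
  (exists_balanced_host hp (D.buckets r m)).choose_spec (6 * k) ((card_buckets_le hD).trans
    (Nat.mul_le_mul_left _ ((Nat.pow_le_pow_right hD.r_pos hk).trans hrp))) s

open Classical in
lemma card_factsAfterOne_le (hk : 3 ≤ k) (hD : D.IsFor r m I) (hrp : r ^ k ≤ p)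
    (hω : LoadsLE D m I T ω) (s : Fin p) :
    (factsAfterOne (fun ω D => CycleStats.routeOne D m ω) ω D I s).card ≤
      (4 ^ k * k + 12 * k) * ⌊T⌋₊ := by
  set C := (D.cells r m).filter fun g => D.cellHost r m s.pos g = s with hC
  set B := (D.buckets r m).filter fun b => D.bucketHost r m s.pos b = s with hB
  have hsub : factsAfterOne (fun ω D => CycleStats.routeOne D m ω) ω D I s ⊆
      (C.biUnion fun g => Finset.univ.biUnion fun j =>
        (cellLoad D m I g j ω).image fun t => ((j, t) : CycleFact k n)) ∪
      B.biUnion fun b => ((deferredLoad I b ω).image fun t => ((b.1, t) : CycleFact k n)) ∪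
        (probeLoad D m I b ω).image fun t => ((prevVar b.1, t) : CycleFact k n) := by
    rintro ⟨j, t⟩ hx
    rw [mem_factsAfterOne] at hx
    obtain ⟨ht, ⟨hd, g, hg, hgs, hf⟩ | ⟨hd, hb⟩ | ⟨hl, h, hh, hb⟩⟩ := hx
    · refine Finset.mem_union_left _ ?_
      simp only [Finset.mem_biUnion, Finset.mem_univ, true_and, Finset.mem_image]
      exact ⟨g, Finset.mem_filter.2 ⟨hg, hgs⟩, j, t, mem_cellLoad.2 ⟨ht, hd, hf⟩, rfl⟩
    · refine Finset.mem_union_right _ (Finset.mem_biUnion.2 ⟨(j, t 1, ω j (t 0)), ?_, ?_⟩)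
      · refine Finset.mem_filter.2 ⟨Finset.mem_filter.2 ⟨Finset.mem_univ _, hd.2.1⟩, hb⟩
      · exact Finset.mem_union_left _ (Finset.mem_image.2
          ⟨t, Finset.mem_filter.2 ⟨ht, rfl, rfl⟩, rfl⟩)
    · refine Finset.mem_union_right _ (Finset.mem_biUnion.2
        ⟨(nextVar j, h, ω (nextVar j) (t 1)), ?_, ?_⟩)
      · refine Finset.mem_filter.2 ⟨Finset.mem_filter.2 ⟨Finset.mem_univ _, hh⟩, hb⟩
      · refine Finset.mem_union_right _ (Finset.mem_image.2 ⟨t, mem_probeLoad.2 ⟨?_, hl, rfl⟩,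
          ?_⟩)
        · dsimp only
          rw [prevVar_nextVar]
          exact ht
        · dsimp only
          rw [prevVar_nextVar]
  refine (Finset.card_le_card hsub).trans ((Finset.card_union_le _ _).trans ?_)
  have h1 : (C.biUnion fun g => Finset.univ.biUnion fun j =>
      (cellLoad D m I g j ω).image fun t => ((j, t) : CycleFact k n)).card
      ≤ 4 ^ k * (k * ⌊T⌋₊) := by
    refine (Finset.card_biUnion_le_card_mul _ _ (k * ⌊T⌋₊) fun g hg => ?_).trans
      (Nat.mul_le_mul_right _ (card_cellHost_fiber_le hD s.pos hrp s))
    refine (Finset.card_biUnion_le_card_mul _ _ ⌊T⌋₊ fun j _ => ?_).trans (by simp)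
    exact Finset.card_image_le.trans
      (Nat.le_floor (hω.cell g (Finset.mem_filter.1 hg).1 j))
  have h2 : (B.biUnion fun b => ((deferredLoad I b ω).image fun t => ((b.1, t) : CycleFact k n)) ∪
        (probeLoad D m I b ω).image fun t => ((prevVar b.1, t) : CycleFact k n)).card
      ≤ 6 * k * (2 * ⌊T⌋₊) := by
    refine (Finset.card_biUnion_le_card_mul _ _ (2 * ⌊T⌋₊) fun b hb => ?_).trans
      (Nat.mul_le_mul_right _ (card_bucketHost_fiber_le hk hD s.pos hrp s))
    have hb' := (Finset.mem_filter.1 hb).1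
    refine (Finset.card_union_le _ _).trans ?_
    rw [two_mul]
    exact add_le_add (Finset.card_image_le.trans (Nat.le_floor (hω.deferred b hb')))
      (Finset.card_image_le.trans (Nat.le_floor (hω.probe b hb')))
  calc _ ≤ 4 ^ k * (k * ⌊T⌋₊) + 6 * k * (2 * ⌊T⌋₊) := add_le_add h1 h2
    _ = _ := by ring

open Classical in
/-- The deferred tuples that reach a cell in the second round are matched by tuples of the
preceding relation that the cell has received in the first round. -/
lemma card_deferred_fits_le (hω : LoadsLE D m I T ω) {g : GridCell k n r} (hg : g ∈ D.cells r m)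
    (j : Fin k) :
    ((cycleRel I j).filter fun t => D.Deferred r m (j, t) ∧ D.FitsFact m ω g (j, t) ∧
      ∃ t', t' ∈ cycleRel I (prevVar j) ∧ t' 1 = t 0 ∧ D.Fits m ω g (prevVar j) (t' 0)).card
      ≤ ⌊T⌋₊ := by
  refine le_trans ?_ (Nat.le_floor (hω.cell g hg (prevVar j)))
  -- A matching tuple ends in a light value, hence is not deferred and was sent to the cell
  -- directly. It determines the deferred tuple: the first value by the match, the second as the
  -- heavy value fixed by the cell.
  refine Finset.card_le_card_of_forall_subsingleton (fun t t' => t' 1 = t 0) ?_ ?_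
  · intro t ht
    obtain ⟨-, hd, hf, t', ht', h1, hf'⟩ := Finset.mem_filter.1 ht
    refine ⟨t', mem_cellLoad.2 ⟨ht', ?_, hf', ?_⟩, h1⟩
    · intro hd'
      have := hd'.2.1
      dsimp only at this
      rw [nextVar_prevVar, h1] at this
      exact hd.1 this
    · dsimp only
      rw [nextVar_prevVar, h1]
      exact hf.1
  · rintro t' - x ⟨hx, hx'⟩ y ⟨hy, hy'⟩
    obtain ⟨-, hdx, hfx, -⟩ := Finset.mem_filter.1 hx
    obtain ⟨-, hdy, hfy, -⟩ := Finset.mem_filter.1 hy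
    refine pair_ext (hx'.symm.trans hy') ?_
    have h1 := hfx.2
    have h2 := hfy.2
    rw [Fits, coord, if_pos hdx.2.1] at h1
    rw [Fits, coord, if_pos hdy.2.1] at h2
    exact Sum.inl.inj (h1.symm.trans h2)

open Classical in
lemma sum_card_factsSentTwo_le (hD : D.IsFor r m I) (hrp : r ^ k ≤ p)
    (hω : LoadsLE D m I T ω) (s : Fin p) :
    ∑ s', (factsSentTwo (fun ω D => CycleStats.routeOne D m ω)
      (fun ω D => CycleStats.routeTwo D m ω) ω D I s' s).card ≤ (4 ^ k * k + 12 * k) * ⌊T⌋₊ := by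
  -- No fact is sent to `s` twice, since only the host of its bucket forwards it; the sum over
  -- senders is therefore the size of a union.
  rw [← Finset.card_biUnion]
  · set C := (D.cells r m).filter fun g => D.cellHost r m s.pos g = s with hC
    have hsub : (Finset.univ.biUnion fun s' => factsSentTwo
        (fun ω D => CycleStats.routeOne D m ω) (fun ω D => CycleStats.routeTwo D m ω) ω D I s' s) ⊆
        C.biUnion fun g => Finset.univ.biUnion fun j =>
          ((cycleRel I j).filter fun t => D.Deferred r m (j, t) ∧ D.FitsFact m ω g (j, t) ∧
            ∃ t', t' ∈ cycleRel I (prevVar j) ∧ t' 1 = t 0 ∧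
              D.Fits m ω g (prevVar j) (t' 0)).image fun t => ((j, t) : CycleFact k n) := by
      rintro ⟨j, t⟩ hx
      obtain ⟨s', -, hx⟩ := Finset.mem_biUnion.1 hx
      rw [mem_factsSentTwo, mem_factsAfterOne] at hx
      obtain ⟨⟨ht, -⟩, hd, -, g, hg, hgs, hf, t', ht', h1, hf'⟩ := hx
      rw [mem_factsAfterOne] at ht'
      simp only [Finset.mem_biUnion, Finset.mem_univ, true_and, Finset.mem_image]
      exact ⟨g, Finset.mem_filter.2 ⟨hg, hgs⟩, j, t,
        Finset.mem_filter.2 ⟨ht, hd, hf, t', ht'.1, h1, hf'⟩, rfl⟩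
    refine (Finset.card_le_card hsub).trans ?_
    calc _ ≤ 4 ^ k * (k * ⌊T⌋₊) := by
          refine (Finset.card_biUnion_le_card_mul _ _ (k * ⌊T⌋₊) fun g hg => ?_).trans
            (Nat.mul_le_mul_right _ (card_cellHost_fiber_le hD s.pos hrp s))
          refine (Finset.card_biUnion_le_card_mul _ _ ⌊T⌋₊ fun j _ => ?_).trans (by simp)
          exact Finset.card_image_le.trans
            (card_deferred_fits_le hω (Finset.mem_filter.1 hg).1 j)
      _ ≤ _ := by
          rw [← mul_assoc]
          exact Nat.mul_le_mul_right _ (Nat.le_add_right _ _)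
  · intro s₁ _ s₂ _ h
    rw [Function.onFun, Finset.disjoint_left]
    intro x h1 h2
    rw [mem_factsSentTwo] at h1 h2
    exact h (h1.2.2.1.symm.trans h2.2.2.1)

end Hosts

end LoadBounds

/-! ### Choice of the grid side and conversion of tuples to bits. -/

section Assembly

open CycleStats

/-- The side length of the grids: the integer part of the `k`-th root of `p`. -/
def gridSide (k p : ℕ) : ℕ := Nat.findGreatest (fun x => x ^ k ≤ p) p

lemma gridSide_pow_le {k : ℕ} (hk : k ≠ 0) (p : ℕ) : gridSide k p ^ k ≤ p :=
  Nat.findGreatest_spec (P := fun x => x ^ k ≤ p) (Nat.zero_le p) (by simp [hk])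

lemma gridSide_pos {k p : ℕ} (hp : 1 ≤ p) : 0 < gridSide k p :=
  Nat.le_findGreatest (P := fun x => x ^ k ≤ p) hp (by simpa using hp)

lemma le_two_mul_gridSide_pow {k p : ℕ} (hk : k ≠ 0) (hp : 1 ≤ p) :
    p ≤ (2 * gridSide k p) ^ k := by
  have h1 : p < (gridSide k p + 1) ^ k := by
    by_cases h : gridSide k p + 1 ≤ p
    · exact not_le.1 (Nat.findGreatest_is_greatest (P := fun x => x ^ k ≤ p)
        (Nat.lt_succ_self _) h)
    · exact (not_le.1 h).trans_le (Nat.le_self_pow hk _)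
  refine h1.le.trans (Nat.pow_le_pow_left ?_ k)
  have := gridSide_pos (k := k) hp
  omega

/-- The number of bits by which a tuple is encoded. -/
def factBits (k n : ℕ) : ℕ := Nat.log 2 (k * n ^ 2) + 1

lemma exists_fact_encoding (k n : ℕ) :
    ∃ (enc : Finset (CycleFact k n) → List Bool) (dec : List Bool → Finset (CycleFact k n)),
      (∀ S, dec (enc S) = S) ∧ ∀ S, (enc S).length = factBits k n * S.card := by
  refine exists_finset_encoding _ (Nat.succ_pos _) ?_
  rw [Fintype.card_prod, Fintype.card_fun, Fintype.card_fin, Fintype.card_fin, Fintype.card_fin]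
  exact (Nat.lt_pow_succ_log_self (by norm_num) _).le

lemma factBits_le {k n : ℕ} (hk : 1 ≤ k) (hn : 2 ≤ n) :
    (factBits k n : ℝ) ≤ (Real.logb 2 k + 3) * Real.logb 2 n := by
  have hk0 : (0 : ℝ) < k := by exact_mod_cast hk
  have hn0 : (0 : ℝ) < n := by exact_mod_cast (by omega : 0 < n)
  have hlk : 0 ≤ Real.logb 2 k := Real.logb_nonneg (by norm_num) (by exact_mod_cast hk)
  have hln : 1 ≤ Real.logb 2 n := by
    rw [Real.le_logb_iff_rpow_le (by norm_num) hn0, Real.rpow_one]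
    exact_mod_cast hn
  have h1 : (Nat.log 2 (k * n ^ 2) : ℝ) ≤ Real.logb 2 k + 2 * Real.logb 2 n := by
    refine (Real.natLog_le_logb _ _).trans (le_of_eq ?_)
    push_cast
    rw [Real.logb_mul hk0.ne' (by positivity), Real.logb_pow]
    norm_num
  rw [factBits]
  push_cast
  nlinarith

/-- The algorithm for the cycle query. -/
noncomputable def cycleAlgorithm (k p n m : ℕ) : MPCAlgorithm (cycleQuery k) p n :=
  twoRoundAlgorithm (Hashes k n (gridSide k p)) (exists_fact_encoding k n).choose
    (exists_fact_encoding k n).choose_spec.choose (fun ω D => CycleStats.routeOne D m ω)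
    (fun ω D => CycleStats.routeTwo D m ω)

/-- An unreported value has degree below `m / p`, hence at most `m / r ^ 3`, because `r ^ 3 ≤ r ^ k
≤ p`. -/
lemma isFor_heavyHitters {k n p m : ℕ} (hk : 3 ≤ k) (hp : 1 ≤ p) (hpm : p ≤ m)
    {I : (cycleQuery k).Instance n} (hI : ∀ j, (I j).card = m) :
    CycleStats.IsFor ((cycleQuery k).heavyHitters p I) (gridSide k p) m I := by
  have h3 : gridSide k p ^ 3 ≤ p :=
    (Nat.pow_le_pow_right (gridSide_pos hp) hk).trans (gridSide_pow_le (by omega) p)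
  set D : CycleStats k n := (cycleQuery k).heavyHitters p I with hD
  have hdeg : ∀ j i v, D j i v = if m ≤ p * cycleDeg I j i v then cycleDeg I j i v else 0 := by
    intro j i v
    rw [← hI j]
    rfl
  refine ⟨hI, gridSide_pos hp, h3.trans hpm, fun j i v => ?_, fun j i v => ?_⟩
  · rw [hdeg]
    split_ifs
    · exact le_rfl
    · exact Nat.zero_le _
  · rw [hdeg]
    split_ifs with h
    · exact Or.inl le_rfl
    · exact Or.inr ((Nat.mul_le_mul_right _ h3).trans (not_le.1 h).le)

lemma cycleAlgorithm_result {k n p m : ℕ} (hp : 1 ≤ p) {I : (cycleQuery k).Instance n}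
    {F : Fin p → (cycleQuery k).Instance n} (hF : (cycleQuery k).IsUniformPartition I F)
    (ω : (cycleAlgorithm k p n m).Rand) (D : CycleStats k n) :
    (cycleAlgorithm k p n m).result ω D F = (cycleQuery k).answer I :=
  twoRoundAlgorithm_result (exists_fact_encoding k n).choose_spec.choose_spec.1 hF ω D
    fun _ ht => route_complete (gridSide_pos hp) hp ω ht

lemma cycleAlgorithm_maxLoad_le {k n p m : ℕ} (hk : 3 ≤ k) {I : (cycleQuery k).Instance n}
    {F : Fin p → (cycleQuery k).Instance n} (hF : (cycleQuery k).IsUniformPartition I F)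
    {D : CycleStats k n} (hD : D.IsFor (gridSide k p) m I) {T : ℝ}
    {ω : Hashes k n (gridSide k p)} (hω : LoadsLE D m I T ω) :
    (cycleAlgorithm k p n m).maxLoad ω D F ≤
      factBits k n * ((4 ^ k * k + 12 * k) * ⌊T⌋₊) :=
  have hrp := gridSide_pow_le (by omega : k ≠ 0) p
  twoRoundAlgorithm_maxLoad_le (exists_fact_encoding k n).choose_spec.choose_spec.1
    (exists_fact_encoding k n).choose_spec.choose_spec.2 hF ω D
    (card_factsAfterOne_le hk hD hrp hω) (sum_card_factsSentTwo_le hD hrp hω)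

lemma div_gridSide_sq_le {k p : ℕ} (hk : k ≠ 0) (hp : 1 ≤ p) {x : ℝ} (hx : 0 ≤ x) :
    x / (gridSide k p : ℝ) ^ 2 ≤ 4 * (x / (p : ℝ) ^ ((2 : ℝ) / k)) := by
  have hp0 : (0 : ℝ) < p := by exact_mod_cast hp
  have hr : (0 : ℝ) < gridSide k p := by exact_mod_cast gridSide_pos hp
  have hk0 : (k : ℝ) ≠ 0 := by exact_mod_cast hk
  have h1 : (p : ℝ) ^ ((2 : ℝ) / k) ≤ 4 * (gridSide k p : ℝ) ^ 2 := by
    calc (p : ℝ) ^ ((2 : ℝ) / k) ≤ ((2 * gridSide k p : ℝ) ^ k) ^ ((2 : ℝ) / k) := by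
          refine Real.rpow_le_rpow hp0.le ?_ (by positivity)
          exact_mod_cast le_two_mul_gridSide_pow hk hp
      _ = (2 * gridSide k p : ℝ) ^ (2 : ℝ) := by
          rw [← Real.rpow_natCast, ← Real.rpow_mul (by positivity)]
          congr 1
          field_simp
      _ = _ := by
          rw [Real.rpow_two]
          ring
  have hq : (0 : ℝ) < (p : ℝ) ^ ((2 : ℝ) / k) := Real.rpow_pos_of_pos hp0 _
  rw [← mul_div_assoc, div_le_div_iff₀ (by positivity) hq]
  nlinarith [mul_le_mul_of_nonneg_left h1 hx]

lemma one_lt_of_card_eq {k n m : ℕ} (hk : 3 ≤ k) (hm : 2 ≤ m) {I : (cycleQuery k).Instance n}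
    (hI : ∀ j, (I j).card = m) : 2 ≤ n := by
  have h1 : m ≤ n ^ 2 := by
    have h : (cycleRel I ⟨0, by omega⟩).card ≤ _ := Finset.card_le_univ _
    rw [Fintype.card_fun, Fintype.card_fin, Fintype.card_fin] at h
    exact (hI ⟨0, by omega⟩).symm.le.trans h
  by_contra hn
  have : n ^ 2 ≤ 1 ^ 2 := Nat.pow_le_pow_left (by omega) 2
  omega

end Assembly

theorem mainTheorem6 (k : ℕ) (hk : 3 ≤ k) :
    ∃ (A : (p n m : ℕ) → MPCAlgorithm (cycleQuery k) p n) (b : ℕ),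
      (∀ p n m : ℕ, (A p n m).rounds ≤ ⌈(k : ℝ) / 2⌉₊) ∧
      ∀ a : ℕ, ∃ C : ℝ, 0 < C ∧
        ∀ p n m : ℕ, 1 ≤ p → p ≤ m →
          ∀ I : (cycleQuery k).Instance n, (∀ j, (I j).card = m) →
            ∀ F : Fin p → (cycleQuery k).Instance n,
              (cycleQuery k).IsUniformPartition I F →
              (∀ ω : (A p n m).Rand,
                (A p n m).result ω ((cycleQuery k).heavyHitters p I) F =
                  (cycleQuery k).answer I) ∧
              1 - 1 / (p : ℝ) ^ a ≤
                (A p n m).prob fun ω =>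
                  ((A p n m).maxLoad ω ((cycleQuery k).heavyHitters p I) F : ℝ) ≤
                    C * (1 + Real.log (p : ℝ)) ^ b *
                      ((2 * (m : ℝ) * Real.logb 2 (n : ℝ)) /
                        (p : ℝ) ^ ((2 : ℝ) / (k : ℝ))) := by
  have hk0 : (3 : ℝ) ≤ k := by exact_mod_cast hk
  refine ⟨cycleAlgorithm k, 2, fun p n m => ?_, fun a => ?_⟩
  · have : 1 < ⌈(k : ℝ) / 2⌉₊ := by
      rw [Nat.lt_ceil]
      push_cast
      linarith
    exact this
  set c₁ : ℝ := 3 * k * 4 ^ k + 12 * k with hc₁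
  have hc₁1 : 1 ≤ c₁ := by
    have : (0 : ℝ) ≤ 3 * k * 4 ^ k := by positivity
    linarith
  set c₂ : ℝ := a + 4 + Real.log c₁ with hc₂
  have hlogc : 0 ≤ Real.log c₁ := Real.log_nonneg hc₁1
  have hc₂0 : 0 < c₂ := by positivity
  have hlogk : 0 ≤ Real.logb 2 (k : ℝ) := Real.logb_nonneg (by norm_num) (by linarith)
  -- The `8` is half of `4 * 4` (from the load threshold and from `r ^ 2` against `p ^ (2/k)`),
  -- since `M = 2 * m * logb 2 n`.
  refine ⟨8 * c₂ ^ 2 * (Real.logb 2 k + 3) * (4 ^ k * k + 12 * k), by positivity,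
    fun p n m hp hpm I hI F hF => ⟨fun ω => cycleAlgorithm_result hp hF ω _, ?_⟩⟩
  have hp1 : (1 : ℝ) ≤ p := by exact_mod_cast hp
  have hD := isFor_heavyHitters hk hp hpm hI
  set D : CycleStats k n := (cycleQuery k).heavyHitters p I with hDdef
  change 1 - 1 / (p : ℝ) ^ a ≤ unifProb (Ω := Hashes k n (gridSide k p)) _
  -- For `p = 1` the required probability is `0`. Otherwise `m ≥ 2` forces `n ≥ 2`, so that `logb 2
  -- n ≥ 1` can absorb the constant number of bits per tuple.
  rcases hp.eq_or_lt with rfl | hp2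
  · simpa using unifProb_nonneg _
  have hn : 2 ≤ n := one_lt_of_card_eq hk (hp2.trans_le hpm) hI
  have hlogp : 0 ≤ Real.log p := Real.log_nonneg hp1
  -- Chosen so that the failure bound `c₁ * p ^ 2 * exp (-t)` is exactly `1 / p ^ a`.
  set t : ℝ := (a + 2) * Real.log p + Real.log c₁ with ht
  have ht0 : 0 ≤ t := by positivity
  have hexp : Real.exp (-t) = 1 / (p ^ (a + 2) * c₁) := by
    rw [Real.exp_neg, ht, Real.exp_add, Real.exp_log (by linarith), one_div]
    congr 2
    rw [show ((a : ℝ) + 2) * Real.log p = Real.log p * ((a + 2 : ℕ) : ℝ) by push_cast; ring,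
      Real.exp_mul, Real.exp_log (by linarith), Real.rpow_natCast]
  have hbad := unifProb_not_loadsLE_le hk hD ht0 (gridSide_pow_le (by omega : k ≠ 0) p)
  have hbad' : unifProb (fun ω : Hashes k n (gridSide k p) =>
      ¬ LoadsLE D m I ((2 + t) ^ 2 * (4 * ((m : ℝ) / gridSide k p ^ 2))) ω) ≤ 1 / (p : ℝ) ^ a := by
    refine hbad.trans (le_of_eq ?_)
    rw [hexp, ← hc₁, pow_add]
    field_simp
  refine le_trans (by linarith) (one_sub_unifProb_le (E' := fun ω : Hashes k n (gridSide k p) =>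
      ¬ LoadsLE D m I ((2 + t) ^ 2 * (4 * ((m : ℝ) / gridSide k p ^ 2))) ω) fun ω hω => ?_)
  have hload := cycleAlgorithm_maxLoad_le hk hF hD (not_not.1 hω)
  have hload' : ((cycleAlgorithm k p n m).maxLoad ω D F : ℝ) ≤ factBits k n *
      ((4 ^ k * k + 12 * k) * ((2 + t) ^ 2 * (4 * ((m : ℝ) / gridSide k p ^ 2)))) := by
    have h1 : ((cycleAlgorithm k p n m).maxLoad ω D F : ℝ) ≤ factBits k n *
        ((4 ^ k * k + 12 * k) *
          (⌊(2 + t) ^ 2 * (4 * ((m : ℝ) / gridSide k p ^ 2))⌋₊ : ℝ)) := by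
      exact_mod_cast hload
    refine h1.trans ?_
    gcongr
    exact Nat.floor_le (by positivity)
  have ht2 : 2 + t ≤ c₂ * (1 + Real.log p) := by
    rw [ht, hc₂]
    nlinarith [mul_nonneg hlogc hlogp, mul_nonneg (Nat.cast_nonneg (α := ℝ) a) hlogp]
  have hln : 0 ≤ Real.logb 2 (n : ℝ) :=
    Real.logb_nonneg (by norm_num) (by exact_mod_cast (by omega : 1 ≤ n))
  calc ((cycleAlgorithm k p n m).maxLoad ω D F : ℝ)
      ≤ factBits k n * ((4 ^ k * k + 12 * k) *
          ((2 + t) ^ 2 * (4 * ((m : ℝ) / gridSide k p ^ 2)))) := hload'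
    _ ≤ ((Real.logb 2 k + 3) * Real.logb 2 n) * ((4 ^ k * k + 12 * k) *
          ((c₂ * (1 + Real.log p)) ^ 2 *
            (4 * (4 * ((m : ℝ) / (p : ℝ) ^ ((2 : ℝ) / k)))))) := by
        gcongr
        · exact factBits_le (by omega) hn
        · exact div_gridSide_sq_le (by omega) hp (Nat.cast_nonneg m)
    _ = _ := by ring
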